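/- Fix integers $d\ge 1$ and $T\ge 2$, and let $\mathbb B_2^d$ be the Euclidean unit ball of $\mathbb R^d$. A learner and an environment interact for $T$ rounds. In each round $t=1,\dots,T$: 1. the environment chooses, possibly at random and depending on the whole past, an expected-loss function $f_t$ with values in $[-1,1]$ on $\mathbb B_2^d$; then a nonempty compact action set $\mathcal A_t\subset\mathbb B_2^d$ is drawn from a fixed distribution $D$, independently of the past and of $f_t$; 2. the learner observes $\mathcal A_t$ and chooses, possibly at random, an action $a_t\in\mathcal A_t$; 3. the learner receives a loss $\ell_t\in[-1,1]$ whose conditional expectation, given the past, $f_t$, $\mathcal A_t$ and $a_t$, is $f_t(a_t)$. The learner knows $d$ and $T$, but neither $D$ nor $f_t$. Let $$\varepsilon_t=\inf_{y\in\mathbb B_2^d}\ \sup_{\mathcal A\in\operatorname{supp}(D)}\ \sup_{a\in\mathcal A}\,|f_t(a)-\langle a,y\rangle| ,$$ and suppose that the losses are linear up to an additive misspecification of size $\varepsilon$, in the sense that $\sqrt{\frac1T\sum_{t=1}^T\varepsilon_t^2}\le\varepsilon$ almost surely. A policy $\pi$ assigns to each action set $\mathcal A$ a probability distribution $\pi(\mathcal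 A)$ on $\mathcal A$, and the regret of the learner with respect to $\pi$ is $$\mathrm{Reg}(\pi)=\mathbb E\Big[\sum_{t=1}^T\Big(f_t(a_t)-\mathbb E_{a\sim\pi(\mathcal A_t)}[f_t(a)]\Big)\Big].$$ Then there is a learning algorithm which does not know $\varepsilon$ and guarantees $$\sup_\pi \mathrm{Reg}(\pi)= O\big(d^2\sqrt T\,\log^2 T+\sqrt d\,\varepsilon T\log T\big).$$ That is, there is a universal constant $C>0$ such that for all $d\ge1$ and $T\ge2$ there is a learning algorithm, depending only on $d$ and $T$, such that for every environment and every $\varepsilon$ as above and every policy $\pi$, $$\mathrm{Reg}(\pi)\le C\big(d^2\sqrt T\,\log^2 T+\sqrt d\,\varepsilon T\log T\big).$$ -/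

import Mathlib

open MeasureTheory ProbabilityTheory

noncomputable section

namespace LinCB

/-- The action space `ℝ^d` with the Euclidean norm. -/
abbrev Action (d : ℕ) : Type := EuclideanSpace ℝ (Fin d)

/-- A context: a nonempty compact action set contained in the Euclidean unit ball. -/
def Context (d : ℕ) : Type :=
  {A : TopologicalSpace.NonemptyCompacts (Action d) //
    (A : Set (Action d)) ⊆ Metric.closedBall 0 1}

/-- The set of available actions. -/
def Context.actions {d : ℕ} (A : Context d) : Set (Action d) := (A.1 : Set (Action d))

/-- The Hausdorff-distance (Vietoris) topology on action sets. -/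
instance (d : ℕ) : TopologicalSpace (Context d) :=
  inferInstanceAs (TopologicalSpace {A : TopologicalSpace.NonemptyCompacts (Action d) //
    (A : Set (Action d)) ⊆ Metric.closedBall 0 1})

instance (d : ℕ) : MeasurableSpace (Context d) := borel _

instance (d : ℕ) : BorelSpace (Context d) := ⟨rfl⟩

/-- What the learner knows about a finished round: the action set, the action it chose together
with its internal random memory of that round, and the loss it received. -/
abbrev Obs (d : ℕ) (Mem : Type) : Type := Context d × (Action d × Mem) × ℝ

/-- A randomized learning algorithm. In round `t` (rounds are numbered from `0`) it draws an action
`a` and an internal memory `m` from a distribution that depends measurably on its observations in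
the preceding rounds and on the current action set; the action always lies in that set. -/
structure Learner (d : ℕ) where
  Mem : Type
  [measMem : MeasurableSpace Mem]
  act : (t : ℕ) → Kernel ((Fin t → Obs d Mem) × Context d) (Action d × Mem)
  [markov_act : ∀ t, IsMarkovKernel (act t)]
  act_mem : ∀ (t : ℕ) (h : Fin t → Obs d Mem) (A : Context d),
    ∀ᵐ p ∂(act t (h, A)), p.1 ∈ A.actions

attribute [instance] Learner.measMem Learner.markov_act

/-- The full record of a round: the environment's hidden move, the action set, the learner's action
and internal memory, and the loss. -/
abbrev Round (d : ℕ) (Mem State : Type) : Type := ((State × Context d) × (Action d × Mem)) × ℝ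

namespace Round

variable {d : ℕ} {Mem State : Type}

def state (r : Round d Mem State) : State := r.1.1.1

def context (r : Round d Mem State) : Context d := r.1.1.2

def action (r : Round d Mem State) : Action d := r.1.2.1

/-- The part of a round that is visible to the learner. -/
def obs (r : Round d Mem State) : Obs d Mem := (r.1.1.2, r.1.2, r.2)

end Round

/-- A (randomized, adaptive) environment playing against a learner with memory space `Mem`.

In round `t` it draws a hidden move `s` from a distribution that depends on the complete past;
past and move fix the expected loss function `f t past s` of the round, which takes values in
`[-1,1]` on the unit ball. The action set is then drawn from the fixed distribution `D`, independently of everything else (see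
`stepKernel`). When the learner has played `a`, the loss is drawn from
`loss t (past, s, A, a)`, a distribution on `[-1,1]` with mean `f t past s a`. -/
structure Environment (d : ℕ) (Mem : Type) [MeasurableSpace Mem] where
  State : Type
  [measState : MeasurableSpace State]
  D : Measure (Context d)
  [prob_D : IsProbabilityMeasure D]
  move : (t : ℕ) → Kernel (Fin t → Round d Mem State) State
  [markov_move : ∀ t, IsMarkovKernel (move t)]
  f : (t : ℕ) → (Fin t → Round d Mem State) → State → Action d → ℝ
  measurable_f : ∀ t : ℕ, Measurable
    (fun x : (Fin t → Round d Mem State) × State × Action d => f t x.1 x.2.1 x.2.2)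
  f_mem : ∀ t h s, ∀ a ∈ Metric.closedBall (0 : Action d) 1, f t h s a ∈ Set.Icc (-1 : ℝ) 1
  loss : (t : ℕ) →
    Kernel ((Fin t → Round d Mem State) × State × Context d × Action d) ℝ
  [markov_loss : ∀ t, IsMarkovKernel (loss t)]
  loss_mem : ∀ t h s A, ∀ a ∈ A.actions, ∀ᵐ l ∂(loss t (h, s, A, a)), l ∈ Set.Icc (-1 : ℝ) 1
  loss_mean : ∀ t h s A, ∀ a ∈ A.actions, ∫ l, l ∂(loss t (h, s, A, a)) = f t h s a

attribute [instance] Environment.measState Environment.prob_D Environment.markov_move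
  Environment.markov_loss

section Interaction

variable {d : ℕ} (L : Learner d) (env : Environment d L.Mem)

theorem measurable_learnerInput (t : ℕ) :
    Measurable (fun x : (Fin t → Round d L.Mem env.State) × (env.State × Context d) =>
      ((fun i => (x.1 i).obs, x.2.2) : (Fin t → Obs d L.Mem) × Context d)) := by
  unfold Round.obs
  fun_prop

theorem measurable_lossInput (t : ℕ) :
    Measurable (fun x : (Fin t → Round d L.Mem env.State) ×
        ((env.State × Context d) × (Action d × L.Mem)) =>
      (x.1, x.2.1.1, x.2.1.2, x.2.2.1)) := by
  fun_prop

/-- The conditional law of round `t` given the past: the environment moves, the action set is drawn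
from `D`, the learner acts, and the loss is drawn. -/
def stepKernel (t : ℕ) :
    Kernel (Fin t → Round d L.Mem env.State) (Round d L.Mem env.State) :=
  ((env.move t ⊗ₖ Kernel.const _ env.D)
    ⊗ₖ (L.act t).comap _ (measurable_learnerInput L env t))
    ⊗ₖ (env.loss t).comap _ (measurable_lossInput L env t)

/-- The law of the first `t` rounds of the interaction of learner and environment. -/
def law : (t : ℕ) → Measure (Fin t → Round d L.Mem env.State)
  | 0 => Measure.dirac Fin.elim0
  | t + 1 => (law t ⊗ₘ stepKernel L env t).map
      (fun p => Fin.snoc (α := fun _ => Round d L.Mem env.State) p.1 p.2)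

/-- The expected loss function of round `t` along the trajectory `h`. -/
def lossFn {T : ℕ} (h : Fin T → Round d L.Mem env.State) (t : Fin T) : Action d → ℝ :=
  env.f t (fun i => h (Fin.castLE t.isLt.le i)) (h t).state

end Interaction

/-- The distance, uniform over the actions of all action sets in the support of `D`, of `g` from
the linear functions `a ↦ ⟨a, y⟩` with `‖y‖ ≤ 1`. -/
def misspec {d : ℕ} (D : Measure (Context d)) (g : Action d → ℝ) : ℝ :=
  ⨅ y : Metric.closedBall (0 : Action d) 1,
    ⨆ a : {a : Action d // ∃ A ∈ D.support, a ∈ A.actions}, |g a - inner ℝ (a : Action d) y|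

/-- Along almost every trajectory, the root mean square over the `T` rounds of the misspecification
is at most `ε`. -/
def MisspecBound {d : ℕ} (L : Learner d) (env : Environment d L.Mem) (T : ℕ) (ε : ℝ) : Prop :=
  ∀ᵐ h ∂(law L env T),
    √((1 / (T : ℝ)) * ∑ t : Fin T, misspec env.D (lossFn L env h t) ^ 2) ≤ ε

/-- A policy assigns to each action set a probability distribution on it. -/
structure Policy (d : ℕ) where
  kernel : Kernel (Context d) (Action d)
  [markov : IsMarkovKernel kernel]
  mem : ∀ A : Context d, ∀ᵐ a ∂(kernel A), a ∈ A.actions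

/-- The regret of the learner with respect to the policy `π` after `T` rounds. -/
def regret {d : ℕ} (L : Learner d) (env : Environment d L.Mem) (T : ℕ) (π : Policy d) : ℝ :=
  ∫ h, ∑ t : Fin T, (lossFn L env h t (h t).action
    - ∫ a, lossFn L env h t a ∂(π.kernel (h t).context)) ∂(law L env T)

end LinCB

end

/-! The learner runs exponential weights over experts `(j, θ)`. The grid point `θ` stands for the
linear policy that plays a minimizer of `⟨·, θ⟩` on whatever action set is drawn; the level `j`
carries a bonus scale `α_j = 2^{-j}`. With mesh `T` and `M = Nat.log 2 T + 2` levels, the logarithm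
of the number of experts is `O(d log T)`.

Comparator. On almost every trajectory the total conditional loss of any policy is within `εT` of a
linear function of its mean action. This survives averaging over trajectories
(`exists_mean_approx_linear`), so in the mean all policies are judged by one deterministic vector
`Y`. Rounding `Y / T` to the grid costs `O(√d)`, hence some linear policy of the grid is nearly as
good as any policy (`exists_netPolicy_le`).

Estimation. For the drawn action set and each level, losses are estimated by ridge least squares,
using only rounds in which an expert of that level is played and the covariance of that part of the
play distribution; `D` is never needed. Let `x` be the action of an expert, `w = xᵀ Σ_j⁻¹ x` its
width and `q_j` the mass of its level. The estimate has second moment at most `w` and bias at most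
`ε (1 + √(q_j w))` plus a ridge term. Averaged over the play distribution, `q_j w` is at most `d`
and `w` at most `dM`, so the learner's own bias costs `O(√d ε)` and its variance `O(η d M)`.

The bonus. The width of the comparator is not controlled by these averages. Each estimated loss is
therefore increased by `α_j (8d - q_j w)`. For the comparator, `ε √(q_j w) ≤ ε² / (4 α_j) + α_j q_j
w`, and the last term is cancelled by the bonus, leaving `ε² / (4 α_j) + 8 d α_j`, which is `O(√d
ε)` when `α_j ≈ ε / √d`. On average over the weights the bonus is nonnegative up to `O(dγ)`, where
`γ` is the exploration rate (`sum_mul_bonus_ge`), so levels other than the right one cost nothing.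
The right level is chosen only in the analysis, since exponential weights compete with every expert;
this is why `ε` need not be known. The outcome for one round is `regret_le_progressBound`.

Exploration. Mixing in a D-optimal design (`exists_design`) with `γ = 4 η d M` keeps all widths
below `1 / (2η)`, as the exponential inequality requires. With `η = 1 / √T` the exploration cost
`O(dγT)` is the leading term `d² √T log T`. -/

noncomputable section

namespace LinCB

/-! ### Measurable selection of minimizers on compact sets -/

/-- A set-valued map with nonempty compact values whose hitting sets of closed sets are
measurable. -/
structure MeasurableCompacts {X E : Type*} [MeasurableSpace X] [TopologicalSpace E]
    (Γ : X → Set E) : Prop where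
  isCompact : ∀ x, IsCompact (Γ x)
  nonempty : ∀ x, (Γ x).Nonempty
  measurableSet_hit : ∀ K : Set E, IsClosed K → MeasurableSet {x | (Γ x ∩ K).Nonempty}

section Selection

variable {X E : Type*} [MeasurableSpace X] [TopologicalSpace E]

/-- By compactness the set of minimizers meets `K` exactly when, for every rational `r`, `Γ x ∩ K`
meets `{φ ≤ r}` as soon as `Γ x` does. This is a countable condition on hitting sets. -/
theorem MeasurableCompacts.argmin {Γ : X → Set E} (hΓ : MeasurableCompacts Γ) {φ : E → ℝ}
    (hφ : Continuous φ) : MeasurableCompacts (fun x => {a ∈ Γ x | ∀ b ∈ Γ x, φ a ≤ φ b}) where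
  isCompact x := by
    have : {a ∈ Γ x | ∀ b ∈ Γ x, φ a ≤ φ b} = Γ x ∩ ⋂ b ∈ Γ x, {a | φ a ≤ φ b} := by
      ext a; simp
    rw [this]
    exact (hΓ.isCompact x).inter_right
      (isClosed_biInter fun b _ => isClosed_le hφ continuous_const)
  nonempty x := by
    obtain ⟨a, ha, hmin⟩ := (hΓ.isCompact x).exists_isMinOn (hΓ.nonempty x) hφ.continuousOn
    exact ⟨a, ha, fun b hb => hmin hb⟩
  measurableSet_hit K hK := by
    have hcl : ∀ r : ℝ, IsClosed {a | φ a ≤ r} := fun r => isClosed_le hφ continuous_const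
    have : {x | ({a ∈ Γ x | ∀ b ∈ Γ x, φ a ≤ φ b} ∩ K).Nonempty} =
        ⋂ r : ℚ, ({x | (Γ x ∩ {a | φ a ≤ (r : ℝ)}).Nonempty}ᶜ ∪
          {x | (Γ x ∩ (K ∩ {a | φ a ≤ (r : ℝ)})).Nonempty}) := by
      ext x
      simp only [Set.mem_iInter, Set.mem_union, Set.mem_compl_iff, Set.mem_ofPred_eq]
      constructor
      · rintro ⟨a, ⟨ha, hmin⟩, haK⟩ r
        by_cases h : (Γ x ∩ {a | φ a ≤ (r : ℝ)}).Nonempty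
        · obtain ⟨b, hb, hbr⟩ := h
          exact Or.inr ⟨a, ha, haK, (hmin b hb).trans hbr⟩
        · exact Or.inl h
      · intro h
        obtain ⟨m, hm, hmin⟩ := (hΓ.isCompact x).exists_isMinOn (hΓ.nonempty x) hφ.continuousOn
        have key : ∀ r : ℚ, φ m < r → (Γ x ∩ (K ∩ {a | φ a ≤ (r : ℝ)})).Nonempty := by
          intro r hr
          rcases h r with h | h
          · exact absurd ⟨m, hm, hr.le⟩ h
          · exact h
        have hne : (Γ x ∩ K).Nonempty := by
          obtain ⟨r, hr⟩ := exists_rat_gt (φ m)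
          obtain ⟨a, ha, haK, -⟩ := key r hr
          exact ⟨a, ha, haK⟩
        obtain ⟨a, ⟨ha, haK⟩, hamin⟩ :=
          ((hΓ.isCompact x).inter_right hK).exists_isMinOn hne hφ.continuousOn
        have ham : φ a ≤ φ m := by
          by_contra! hlt
          obtain ⟨r, hr1, hr2⟩ := exists_rat_btwn hlt
          obtain ⟨b, hb, hbK, hbr⟩ := key r hr1
          exact absurd ((hamin ⟨hb, hbK⟩ : φ a ≤ φ b).trans hbr) (not_le.2 hr2)
        exact ⟨a, ⟨ha, fun b hb => ham.trans (hmin hb)⟩, haK⟩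
    rw [this]
    exact MeasurableSet.iInter fun r => (hΓ.measurableSet_hit _ (hcl r)).compl.union
      (hΓ.measurableSet_hit _ (hK.inter (hcl r)))

/-- Minimizing the coordinates one after another is a lexicographic tie-break. Once all coordinates
are used a single point remains, and the preimage of a closed set under the selector is a hitting
set. -/
theorem MeasurableCompacts.exists_const_on_list {d : ℕ} {Γ : X → Set (Action d)}
    (hΓ : MeasurableCompacts Γ) (l : List (Fin d)) :
    ∃ Γ' : X → Set (Action d), MeasurableCompacts Γ' ∧ (∀ x, Γ' x ⊆ Γ x) ∧
      ∀ i ∈ l, ∀ x, ∀ a ∈ Γ' x, ∀ b ∈ Γ' x, a i = b i := by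
  induction l with
  | nil => exact ⟨Γ, hΓ, fun _ => subset_rfl, by simp⟩
  | cons i l ih =>
    obtain ⟨Γ', h1, h2, h3⟩ := ih
    have hc : Continuous (fun a : Action d => a i) := by fun_prop
    refine ⟨_, h1.argmin hc, fun x => (Set.sep_subset _ _).trans (h2 x), ?_⟩
    intro k hk x a ha b hb
    rcases List.mem_cons.1 hk with rfl | hk
    · exact le_antisymm (ha.2 b hb.1) (hb.2 a ha.1)
    · exact h3 k hk x a ha.1 b hb.1

/-- Measurable selection of a minimizer of a continuous function. -/
theorem MeasurableCompacts.exists_measurable_argmin {d : ℕ} {Γ : X → Set (Action d)}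
    (hΓ : MeasurableCompacts Γ) {φ : Action d → ℝ} (hφ : Continuous φ) :
    ∃ σ : X → Action d, Measurable σ ∧ (∀ x, σ x ∈ Γ x) ∧ ∀ x, ∀ b ∈ Γ x, φ (σ x) ≤ φ b := by
  obtain ⟨Γ', h1, h2, h3⟩ := (hΓ.argmin hφ).exists_const_on_list (List.finRange d)
  choose σ hσ using h1.nonempty
  refine ⟨σ, ?_, fun x => (h2 x (hσ x)).1, fun x b hb => (h2 x (hσ x)).2 b hb⟩
  refine measurable_of_isClosed fun K hK => ?_
  have : σ ⁻¹' K = {x | (Γ' x ∩ K).Nonempty} := by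
    ext x
    refine ⟨fun h => ⟨σ x, hσ x, h⟩, ?_⟩
    rintro ⟨a, ha, haK⟩
    have : a = σ x := by
      ext i
      exact h3 i (List.mem_finRange i) x a ha (σ x) (hσ x)
    rw [Set.mem_preimage, ← this]
    exact haK
  rw [this]
  exact h1.measurableSet_hit K hK

end Selection

/-! ### Linear policies on action sets -/

/-- Second countability makes the support of `D` a set of full measure, so the misspecification
bound, which only concerns the support, holds for almost every drawn action set. -/
instance (d : ℕ) : SecondCountableTopology (Context d) :=
  inferInstanceAs (SecondCountableTopology {A : TopologicalSpace.NonemptyCompacts (Action d) //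
    (A : Set (Action d)) ⊆ Metric.closedBall 0 1})

theorem measurableCompacts_actions (d : ℕ) :
    MeasurableCompacts (fun A : Context d => A.actions) where
  isCompact A := A.1.isCompact
  nonempty A := A.1.nonempty
  measurableSet_hit K hK := by
    have hc : Continuous (fun A : Context d => A.1) := continuous_subtype_val
    exact ((TopologicalSpace.NonemptyCompacts.isClosed_inter_nonempty_of_isClosed hK).preimage
      hc).measurableSet

theorem exists_measurable_linear_argmin {d : ℕ} (θ : Action d) :
    ∃ σ : Context d → Action d, Measurable σ ∧ (∀ A, σ A ∈ A.actions) ∧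
      ∀ A, ∀ b ∈ A.actions, inner ℝ (σ A) θ ≤ inner ℝ b θ :=
  (measurableCompacts_actions d).exists_measurable_argmin (φ := fun a => inner ℝ a θ)
    (by fun_prop)

/-- The linear policy which minimizes `⟨·, θ⟩`. -/
def linPolicy {d : ℕ} (θ : Action d) : Context d → Action d :=
  (exists_measurable_linear_argmin θ).choose

theorem measurable_linPolicy {d : ℕ} (θ : Action d) : Measurable (linPolicy θ) :=
  (exists_measurable_linear_argmin θ).choose_spec.1

theorem linPolicy_mem {d : ℕ} (θ : Action d) (A : Context d) : linPolicy θ A ∈ A.actions :=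
  (exists_measurable_linear_argmin θ).choose_spec.2.1 A

theorem inner_linPolicy_le {d : ℕ} (θ : Action d) (A : Context d) {b : Action d}
    (hb : b ∈ A.actions) : inner ℝ (linPolicy θ A) θ ≤ inner ℝ b θ :=
  (exists_measurable_linear_argmin θ).choose_spec.2.2 A b hb

theorem Context.norm_le_one {d : ℕ} {A : Context d} {a : Action d} (ha : a ∈ A.actions) :
    ‖a‖ ≤ 1 := by
  simpa using A.2 ha

/-! ### Regularized covariance matrices, their inverse forms, and optimal design -/

section Gram

open Matrix

variable {d : ℕ} {ι : Type*} [Fintype ι]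

/-- The regularized covariance matrix `∑ i, p i • x i (x i)ᵀ + lam • 1`. -/
def gram (p : ι → ℝ) (x : ι → Fin d → ℝ) (lam : ℝ) : Matrix (Fin d) (Fin d) ℝ :=
  ∑ i, p i • vecMulVec (x i) (x i) + lam • 1

/-- The bilinear form of the inverse of the regularized covariance matrix. -/
def invForm (p : ι → ℝ) (x : ι → Fin d → ℝ) (lam : ℝ) (u v : Fin d → ℝ) : ℝ :=
  u ⬝ᵥ ((gram p x lam)⁻¹ *ᵥ v)

variable {p : ι → ℝ} {x : ι → Fin d → ℝ} {lam : ℝ}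

theorem gram_isSymm : (gram p x lam)ᵀ = gram p x lam := by
  simp [gram, transpose_sum, transpose_vecMulVec]

theorem dotProduct_gram_mulVec (u v : Fin d → ℝ) :
    u ⬝ᵥ (gram p x lam *ᵥ v) = ∑ i, p i * (x i ⬝ᵥ u) * (x i ⬝ᵥ v) + lam * (u ⬝ᵥ v) := by
  simp only [gram, add_mulVec, dotProduct_add, sum_mulVec, dotProduct_sum, smul_mulVec,
    dotProduct_smul, one_mulVec, vecMulVec_mulVec, smul_eq_mul]
  congr 1
  refine Finset.sum_congr rfl fun i _ => ?_
  simp [dotProduct_comm u (x i)]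
  ring

theorem gram_posDef (hp : ∀ i, 0 ≤ p i) (hl : 0 < lam) : (gram p x lam).PosDef := by
  refine PosDef.of_dotProduct_mulVec_pos ?_ fun v hv => ?_
  · rw [IsHermitian, conjTranspose_eq_transpose_of_trivial, gram_isSymm]
  · rw [star_trivial, dotProduct_gram_mulVec]
    have h1 : 0 < v ⬝ᵥ v := by simpa using dotProduct_star_self_pos_iff.2 hv
    have h2 : 0 ≤ ∑ i, p i * (x i ⬝ᵥ v) * (x i ⬝ᵥ v) :=
      Finset.sum_nonneg fun i _ => by
        rw [mul_assoc]; exact mul_nonneg (hp i) (mul_self_nonneg _)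
    positivity

theorem isUnit_det_gram (hp : ∀ i, 0 ≤ p i) (hl : 0 < lam) : IsUnit (gram p x lam).det :=
  (gram_posDef hp hl).det_pos.ne'.isUnit

theorem gram_mulVec_inv_mulVec (hp : ∀ i, 0 ≤ p i) (hl : 0 < lam) (v : Fin d → ℝ) :
    gram p x lam *ᵥ ((gram p x lam)⁻¹ *ᵥ v) = v := by
  rw [mulVec_mulVec, mul_nonsing_inv _ (isUnit_det_gram hp hl), one_mulVec]

/-- The defining relation of the inverse form. -/
theorem sum_mul_invForm (hp : ∀ i, 0 ≤ p i) (hl : 0 < lam) (u v : Fin d → ℝ) :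
    u ⬝ᵥ v = ∑ i, p i * (x i ⬝ᵥ u) * invForm p x lam (x i) v
      + lam * (u ⬝ᵥ ((gram p x lam)⁻¹ *ᵥ v)) := by
  have h := dotProduct_gram_mulVec (p := p) (x := x) (lam := lam) u ((gram p x lam)⁻¹ *ᵥ v)
  rwa [gram_mulVec_inv_mulVec hp hl] at h

theorem invForm_eq_sum (hp : ∀ i, 0 ≤ p i) (hl : 0 < lam) (u v : Fin d → ℝ) :
    invForm p x lam v u = ∑ i, p i * invForm p x lam (x i) u * invForm p x lam (x i) v
      + lam * (((gram p x lam)⁻¹ *ᵥ u) ⬝ᵥ ((gram p x lam)⁻¹ *ᵥ v)) := by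
  rw [invForm, dotProduct_comm]
  exact sum_mul_invForm hp hl _ v

theorem invForm_comm (hp : ∀ i, 0 ≤ p i) (hl : 0 < lam) (u v : Fin d → ℝ) :
    invForm p x lam u v = invForm p x lam v u := by
  rw [invForm_eq_sum hp hl u v, invForm_eq_sum hp hl v u, dotProduct_comm]
  congr 1
  exact Finset.sum_congr rfl fun i _ => by ring

theorem invForm_self_nonneg (hp : ∀ i, 0 ≤ p i) (hl : 0 < lam) (u : Fin d → ℝ) :
    0 ≤ invForm p x lam u u := by
  rw [invForm_eq_sum hp hl]
  refine add_nonneg (Finset.sum_nonneg fun i _ => ?_) (mul_nonneg hl.le ?_)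
  · rw [mul_assoc]; exact mul_nonneg (hp i) (mul_self_nonneg _)
  · simpa using dotProduct_star_self_nonneg ((gram p x lam)⁻¹ *ᵥ u)

/-- Bounds the second moment of the least-squares estimate: `Σ⁻¹ (Σ - lam) Σ⁻¹ ≤ Σ⁻¹`. -/
theorem sum_mul_invForm_sq_le (hp : ∀ i, 0 ≤ p i) (hl : 0 < lam) (u : Fin d → ℝ) :
    ∑ i, p i * invForm p x lam u (x i) ^ 2 ≤ invForm p x lam u u := by
  rw [invForm_eq_sum hp hl u u]
  have h : 0 ≤ ((gram p x lam)⁻¹ *ᵥ u) ⬝ᵥ ((gram p x lam)⁻¹ *ᵥ u) := by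
    simpa using dotProduct_star_self_nonneg ((gram p x lam)⁻¹ *ᵥ u)
  have : ∑ i, p i * invForm p x lam u (x i) ^ 2 =
      ∑ i, p i * invForm p x lam (x i) u * invForm p x lam (x i) u :=
    Finset.sum_congr rfl fun i _ => by rw [invForm_comm hp hl u (x i)]; ring
  rw [this]
  nlinarith [mul_nonneg hl.le h]

theorem invForm_sq_le (hp : ∀ i, 0 ≤ p i) (hl : 0 < lam) (u v : Fin d → ℝ) :
    invForm p x lam u v ^ 2 ≤ invForm p x lam u u * invForm p x lam v v := by
  have key : ∀ s t : ℝ, 0 ≤ s ^ 2 * invForm p x lam u u - 2 * s * t * invForm p x lam u v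
      + t ^ 2 * invForm p x lam v v := by
    intro s t
    have h := invForm_self_nonneg (x := x) hp hl (s • u - t • v)
    have e : invForm p x lam (s • u - t • v) (s • u - t • v) =
        s ^ 2 * invForm p x lam u u - s * t * invForm p x lam u v
          - s * t * invForm p x lam v u + t ^ 2 * invForm p x lam v v := by
      simp only [invForm, mulVec_sub, mulVec_smul, sub_dotProduct, dotProduct_sub,
        smul_dotProduct, dotProduct_smul, smul_eq_mul]
      ring
    rw [e, invForm_comm hp hl v u] at h
    linarith
  have hu := invForm_self_nonneg (x := x) hp hl u
  have h := key (invForm p x lam u v) (invForm p x lam u u)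
  rcases hu.eq_or_lt with h0 | h0
  -- In the degenerate case this choice of `s` and `t` turns the quadratic inequality into `0 ≤
  -- -(B(v,v) + 2) B(u,v)²`, with `B` the inverse form.
  · have := key (invForm p x lam v v + 1) (invForm p x lam u v)
    rw [← h0] at this ⊢
    nlinarith [invForm_self_nonneg (x := x) hp hl v]
  · have : 0 ≤ invForm p x lam u u *
        (invForm p x lam u u * invForm p x lam v v - invForm p x lam u v ^ 2) := by nlinarith
    have := nonneg_of_mul_nonneg_right this h0
    linarith

/-- The left side is the trace of `Σ⁻¹ (Σ - lam)`, which is `d` minus a nonnegative trace. -/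
theorem sum_mul_invForm_self_le (hp : ∀ i, 0 ≤ p i) (hl : 0 < lam) :
    ∑ i, p i * invForm p x lam (x i) (x i) ≤ d := by
  have h1 : ((gram p x lam)⁻¹ * gram p x lam).trace = d := by
    rw [nonsing_inv_mul _ (isUnit_det_gram hp hl)]; simp
  have h2 : ((gram p x lam)⁻¹ * gram p x lam).trace =
      ∑ i, p i * invForm p x lam (x i) (x i) + lam * (gram p x lam)⁻¹.trace := by
    nth_rewrite 2 [gram]
    simp only [mul_add, Finset.mul_sum, trace_add, trace_sum, mul_smul_comm, trace_smul, mul_one,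
      smul_eq_mul, mul_vecMulVec, trace_vecMulVec, invForm]
    congr 1
    exact Finset.sum_congr rfl fun i _ => by rw [dotProduct_comm]
  have h3 : 0 ≤ (gram p x lam)⁻¹.trace := by
    refine Finset.sum_nonneg fun i _ => ?_
    have := invForm_self_nonneg (x := x) hp hl (Pi.single i 1)
    simpa [invForm] using this
  nlinarith [mul_nonneg hl.le h3]

/-- For exactly linear losses the only bias comes from the ridge: it equals `-lam ⟨y, Σ⁻¹ u⟩`, and
`lam ‖Σ⁻¹ u‖²` is at most the inverse form at `u`. -/
theorem abs_sum_mul_invForm_sub_le (hp : ∀ i, 0 ≤ p i) (hl : 0 < lam) (u y : Fin d → ℝ)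
    (hy : y ⬝ᵥ y ≤ 1) :
    |∑ i, p i * invForm p x lam u (x i) * (x i ⬝ᵥ y) - u ⬝ᵥ y|
      ≤ √(lam * invForm p x lam u u) := by
  have h := sum_mul_invForm (x := x) hp hl y u
  have e : ∑ i, p i * invForm p x lam u (x i) * (x i ⬝ᵥ y) =
      ∑ i, p i * (x i ⬝ᵥ y) * invForm p x lam (x i) u :=
    Finset.sum_congr rfl fun i _ => by rw [invForm_comm hp hl u (x i)]; ring
  set z := (gram p x lam)⁻¹ *ᵥ u with hz
  have hz1 : lam * (z ⬝ᵥ z) ≤ invForm p x lam u u := by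
    rw [invForm_eq_sum hp hl u u]
    have : 0 ≤ ∑ i, p i * invForm p x lam (x i) u * invForm p x lam (x i) u :=
      Finset.sum_nonneg fun i _ => by
        rw [mul_assoc]; exact mul_nonneg (hp i) (mul_self_nonneg _)
    linarith
  have hcs : (y ⬝ᵥ z) ^ 2 ≤ (y ⬝ᵥ y) * (z ⬝ᵥ z) := by
    have := Finset.sum_mul_sq_le_sq_mul_sq Finset.univ y z
    simpa [dotProduct, sq] using this
  have hzz : 0 ≤ z ⬝ᵥ z := by simpa using dotProduct_star_self_nonneg z
  rw [e, dotProduct_comm u y]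
  refine Real.abs_le_sqrt ?_
  have e2 : ∑ i, p i * (x i ⬝ᵥ y) * invForm p x lam (x i) u - y ⬝ᵥ u = -(lam * (y ⬝ᵥ z)) := by
    linarith
  rw [e2]
  have : (y ⬝ᵥ z) ^ 2 ≤ z ⬝ᵥ z := hcs.trans (by nlinarith)
  calc (-(lam * (y ⬝ᵥ z))) ^ 2 = lam * (lam * (y ⬝ᵥ z) ^ 2) := by ring
    _ ≤ lam * (lam * (z ⬝ᵥ z)) := by gcongr
    _ ≤ _ := by gcongr

/-- Bias caused by misspecification, by Cauchy–Schwarz. The total mass `∑ p` is kept in the bound: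
it becomes the level mass, which keeps the number of levels out of the cost of misspecification. -/
theorem abs_sum_mul_invForm_le (hp : ∀ i, 0 ≤ p i) (hl : 0 < lam) (u : Fin d → ℝ) (δ : ι → ℝ)
    {ε : ℝ} (hδ : ∀ i, |δ i| ≤ ε) (hε : 0 ≤ ε) :
    |∑ i, p i * invForm p x lam u (x i) * δ i|
      ≤ ε * √((∑ i, p i) * invForm p x lam u u) := by
  have h0 : 0 ≤ ∑ i, p i := Finset.sum_nonneg fun i _ => hp i
  have h1 : (∑ i, p i * |invForm p x lam u (x i)|) ^ 2 ≤
      (∑ i, p i) * invForm p x lam u u := by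
    have := Finset.sum_mul_sq_le_sq_mul_sq Finset.univ (fun i => √(p i))
      (fun i => √(p i) * |invForm p x lam u (x i)|)
    have e1 : ∀ i, √(p i) * (√(p i) * |invForm p x lam u (x i)|) =
        p i * |invForm p x lam u (x i)| := fun i => by
      rw [← mul_assoc, Real.mul_self_sqrt (hp i)]
    have e2 : ∀ i, (√(p i) * |invForm p x lam u (x i)|) ^ 2 =
        p i * invForm p x lam u (x i) ^ 2 := fun i => by
      rw [mul_pow, Real.sq_sqrt (hp i), sq_abs]
    simp only [e1, e2, Real.sq_sqrt (hp _)] at this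
    exact this.trans (mul_le_mul_of_nonneg_left (sum_mul_invForm_sq_le hp hl u) h0)
  have h2 := Real.abs_le_sqrt h1
  calc |∑ i, p i * invForm p x lam u (x i) * δ i|
      ≤ ∑ i, |p i * invForm p x lam u (x i) * δ i| := Finset.abs_sum_le_sum_abs _ _
    _ ≤ ∑ i, ε * (p i * |invForm p x lam u (x i)|) := by
        refine Finset.sum_le_sum fun i _ => ?_
        rw [abs_mul, abs_mul, abs_of_nonneg (hp i), mul_comm ε]
        exact mul_le_mul_of_nonneg_left (hδ i) (mul_nonneg (hp i) (abs_nonneg _))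
    _ = ε * ∑ i, p i * |invForm p x lam u (x i)| := by rw [Finset.mul_sum]
    _ ≤ _ := mul_le_mul_of_nonneg_left ((le_abs_self _).trans h2) hε

/-- Comparison of inverse forms: a larger covariance has a smaller inverse. -/
theorem invForm_le_of_quadratic_le {κ : Type*} [Fintype κ] {p' : κ → ℝ} {x' : κ → Fin d → ℝ}
    {lam' c : ℝ} (hp : ∀ i, 0 ≤ p i) (hl : 0 < lam) (hp' : ∀ i, 0 ≤ p' i) (hl' : 0 < lam')
    (hc : 0 < c)
    (h : ∀ v : Fin d → ℝ, c * (∑ i, p' i * (x' i ⬝ᵥ v) ^ 2 + lam' * (v ⬝ᵥ v)) ≤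
      ∑ i, p i * (x i ⬝ᵥ v) ^ 2 + lam * (v ⬝ᵥ v)) (u : Fin d → ℝ) :
    invForm p x lam u u ≤ invForm p' x' lam' u u / c := by
  set z := (gram p x lam)⁻¹ *ᵥ u with hz
  set z' := (gram p' x' lam')⁻¹ *ᵥ u with hz'
  have q : ∀ v : Fin d → ℝ, v ⬝ᵥ (gram p x lam *ᵥ v) =
      ∑ i, p i * (x i ⬝ᵥ v) ^ 2 + lam * (v ⬝ᵥ v) := fun v => by
    rw [dotProduct_gram_mulVec]; simp only [sq, mul_assoc]
  have q' : ∀ v : Fin d → ℝ, v ⬝ᵥ (gram p' x' lam' *ᵥ v) =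
      ∑ i, p' i * (x' i ⬝ᵥ v) ^ 2 + lam' * (v ⬝ᵥ v) := fun v => by
    rw [dotProduct_gram_mulVec]; simp only [sq, mul_assoc]
  have e1 : gram p x lam *ᵥ z = u := gram_mulVec_inv_mulVec hp hl u
  have e2 : gram p' x' lam' *ᵥ z' = u := gram_mulVec_inv_mulVec hp' hl' u
  have hzz := h z
  rw [← q, ← q', e1] at hzz
  -- With `G'` the second matrix, this form expands to `c² zᵀG'z - 2c z·u + z'·u`. The hypothesis at
  -- `z` gives `c zᵀG'z ≤ z·u`, and what remains is `c z·u ≤ z'·u`.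
  have hn : 0 ≤ (c • z - z') ⬝ᵥ (gram p' x' lam' *ᵥ (c • z - z')) := by
    rw [q']
    refine add_nonneg (Finset.sum_nonneg fun i _ => mul_nonneg (hp' i) (sq_nonneg _))
      (mul_nonneg hl'.le ?_)
    simpa using dotProduct_star_self_nonneg (c • z - z')
  have hsym : z' ⬝ᵥ (gram p' x' lam' *ᵥ z) = z ⬝ᵥ u := by
    rw [← e2, dotProduct_gram_mulVec, dotProduct_gram_mulVec, dotProduct_comm z z']
    congr 1
    exact Finset.sum_congr rfl fun i _ => by ring
  have ex : (c • z - z') ⬝ᵥ (gram p' x' lam' *ᵥ (c • z - z')) =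
      c * (c * (z ⬝ᵥ (gram p' x' lam' *ᵥ z))) - c * (z ⬝ᵥ u) - c * (z ⬝ᵥ u) + z' ⬝ᵥ u := by
    simp only [mulVec_sub, mulVec_smul, sub_dotProduct, dotProduct_sub, smul_dotProduct,
      dotProduct_smul, smul_eq_mul, hsym, e2]
    ring
  rw [ex] at hn
  have i1 : invForm p x lam u u = z ⬝ᵥ u := by rw [invForm, dotProduct_comm]
  have i2 : invForm p' x' lam' u u = z' ⬝ᵥ u := by rw [invForm, dotProduct_comm]
  rw [i1, i2, le_div_iff₀ hc]
  nlinarith [mul_le_mul_of_nonneg_left hzz hc.le]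

/-- A regularized D-optimal design is a G-optimal design up to constants. -/
theorem exists_design [Nonempty ι] (hd : 1 ≤ d) (hl : 0 < lam) (x : ι → Fin d → ℝ) :
    ∃ τ : Fin (2 * d) → ι, ∀ i,
      invForm (fun _ => 1) (fun k => x (τ k)) lam (x i) (x i) ≤ 1 := by
  classical
  -- The design is a choice of `2d` points, with repetition, of maximal determinant. Twice the
  -- dimension leaves room for a point of width at most `1/2`, because the widths sum to at most
  -- `d`.
  obtain ⟨τ, hτ⟩ := Finite.exists_max
    (fun τ : Fin (2 * d) → ι => (gram (fun _ => 1) (fun k => x (τ k)) lam).det)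
  refine ⟨τ, fun i => ?_⟩
  have h1 : ∀ k : Fin (2 * d), (0 : ℝ) ≤ (fun _ => 1) k := fun _ => zero_le_one
  obtain ⟨k, hk⟩ : ∃ k, invForm (fun _ => 1) (fun k => x (τ k)) lam (x (τ k)) (x (τ k))
      ≤ 1 / 2 := by
    by_contra! hcon
    have hs := sum_mul_invForm_self_le (x := fun k => x (τ k)) h1 hl
    have : ∑ _k : Fin (2 * d), (1 / 2 : ℝ) < ∑ k, (fun _ => (1 : ℝ)) k *
        invForm (fun _ => 1) (fun k => x (τ k)) lam (x (τ k)) (x (τ k)) := by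
      refine Finset.sum_lt_sum_of_nonempty ⟨⟨0, by omega⟩, Finset.mem_univ _⟩ fun k _ => ?_
      simpa using hcon k
    simp at this hs
    linarith
  -- `U` is the covariance without the `k`-th design point. By the matrix determinant lemma,
  -- optimality of the design means that no candidate has a larger `U⁻¹`-width than the point that
  -- was removed.
  set U := gram (fun l => if l = k then (0 : ℝ) else 1) (fun k => x (τ k)) lam with hU
  have hp0 : ∀ l : Fin (2 * d), (0 : ℝ) ≤ (fun l => if l = k then (0 : ℝ) else 1) l :=
    fun l => by dsimp only; split_ifs <;> norm_num
  have hUd : IsUnit U.det := isUnit_det_gram hp0 hl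
  have hupd : ∀ i', gram (fun _ => 1) (fun l => x (Function.update τ k i' l)) lam =
      U + vecMulVec (x i') (x i') := by
    intro i'
    have e : ∀ l, (1 : ℝ) • vecMulVec (x (Function.update τ k i' l))
        (x (Function.update τ k i' l)) =
        (if l = k then (0 : ℝ) else 1) • vecMulVec (x (τ l)) (x (τ l)) +
          if l = k then vecMulVec (x i') (x i') else 0 := by
      intro l
      by_cases hlk : l = k
      · subst hlk; simp
      · simp [hlk]
    rw [hU, gram, gram, Finset.sum_congr rfl fun l _ => e l, Finset.sum_add_distrib]
    simp
    abel
  have hdet : ∀ v : Fin d → ℝ, (U + vecMulVec v v).det = U.det * (1 + v ⬝ᵥ (U⁻¹ *ᵥ v)) := by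
    intro v
    rw [vecMulVec_eq Unit, det_add_replicateCol_mul_replicateRow hUd]
    congr 1
    rw [det_unique]
    rw [Matrix.mul_assoc, ← replicateCol_mulVec]
    simp [replicateRow_mul_replicateCol_apply]
  have hmax := hτ (Function.update τ k i)
  have hself : gram (fun _ => 1) (fun l => x (τ l)) lam = U + vecMulVec (x (τ k)) (x (τ k)) := by
    simpa using hupd (τ k)
  simp only [hupd i, hself, hdet] at hmax
  have hUpos : 0 < U.det := (gram_posDef hp0 hl).det_pos
  have hle : x i ⬝ᵥ (U⁻¹ *ᵥ x i) ≤ x (τ k) ⬝ᵥ (U⁻¹ *ᵥ x (τ k)) := by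
    have := le_of_mul_le_mul_left hmax hUpos
    linarith
  set r := x (τ k) ⬝ᵥ (U⁻¹ *ᵥ x (τ k)) with hr
  set w := invForm (fun _ => 1) (fun k => x (τ k)) lam (x (τ k)) (x (τ k)) with hw
  -- Sherman–Morrison: `r = w / (1 - w)`, so `w ≤ 1/2` gives `r ≤ 1`. Restoring the removed point
  -- only decreases the inverse form.
  have hwr : w = (1 - w) * r := by
    set z := (gram (fun _ => (1 : ℝ)) (fun l => x (τ l)) lam)⁻¹ *ᵥ x (τ k) with hz
    have hwz : w = x (τ k) ⬝ᵥ z := rfl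
    have e1 : (U + vecMulVec (x (τ k)) (x (τ k))) *ᵥ z = x (τ k) := by
      rw [← hself]; exact gram_mulVec_inv_mulVec h1 hl _
    have e2 : U *ᵥ z = (1 - w) • x (τ k) := by
      rw [add_mulVec, vecMulVec_mulVec, ← hwz] at e1
      rw [sub_smul, one_smul, eq_sub_iff_add_eq]
      simpa using e1
    have e3 : z = (1 - w) • (U⁻¹ *ᵥ x (τ k)) := by
      rw [← mulVec_smul, ← e2, mulVec_mulVec, nonsing_inv_mul _ hUd, one_mulVec]
    calc w = x (τ k) ⬝ᵥ ((1 - w) • (U⁻¹ *ᵥ x (τ k))) := by rw [← e3]; exact hwz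
      _ = (1 - w) * r := by rw [dotProduct_smul, smul_eq_mul]
  have hr1 : r ≤ 1 := by nlinarith
  have hcomp := invForm_le_of_quadratic_le (x := fun l => x (τ l)) (x' := fun l => x (τ l)) h1 hl
    hp0 hl one_pos (fun v => by
      rw [one_mul]
      gcongr with l
      split_ifs <;> norm_num) (x i)
  rw [div_one] at hcomp
  exact hcomp.trans (hle.trans hr1)

end Gram

/-! ### Exponential weights and their potential -/

section ExpWeights

variable {E : Type*} [Fintype E]

/-- Exponential weights with learning rate `η` for the cumulative losses `c`. -/
def expWeights (η : ℝ) (c : E → ℝ) (e : E) : ℝ :=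
  Real.exp (-η * c e) / ∑ e', Real.exp (-η * c e')

/-- The potential of exponential weights. -/
def expPotential (η : ℝ) (c : E → ℝ) : ℝ :=
  -(1 / η) * Real.log ((∑ e, Real.exp (-η * c e)) / Fintype.card E)

theorem expWeights_nonneg (η : ℝ) (c : E → ℝ) (e : E) : 0 ≤ expWeights η c e :=
  div_nonneg (Real.exp_pos _).le (Finset.sum_nonneg fun _ _ => (Real.exp_pos _).le)

/-- Only an upper bound on `x` is needed, so estimated losses must be bounded below by `-1 / η` but
not above. -/
theorem exp_le_one_add_add_sq {x : ℝ} (hx : x ≤ 1) : Real.exp x ≤ 1 + x + x ^ 2 := by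
  rcases le_or_gt (-1) x with h | h
  · have := Real.abs_exp_sub_one_sub_id_le (abs_le.2 ⟨h, hx⟩)
    linarith [(abs_le.1 this).2]
  · have := Real.exp_le_one_iff.2 (by linarith : x ≤ 0)
    nlinarith

variable [Nonempty E] {η : ℝ}

theorem sum_exp_pos (η : ℝ) (c : E → ℝ) : 0 < ∑ e, Real.exp (-η * c e) :=
  Finset.sum_pos (fun _ _ => Real.exp_pos _) Finset.univ_nonempty

theorem sum_expWeights (η : ℝ) (c : E → ℝ) : ∑ e, expWeights η c e = 1 := by
  simp only [expWeights]
  rw [← Finset.sum_div, div_self (sum_exp_pos η c).ne']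

theorem expPotential_zero (η : ℝ) : expPotential η (fun _ : E => 0) = 0 := by
  simp [expPotential]

/-- The potential is a soft minimum: one summand already bounds the sum of exponentials from below.
-/
theorem expPotential_le (hη : 0 < η) (c : E → ℝ) (e : E) :
    expPotential η c ≤ c e + Real.log (Fintype.card E) / η := by
  have h1 : Real.exp (-η * c e) ≤ ∑ e, Real.exp (-η * c e) :=
    Finset.single_le_sum (f := fun e => Real.exp (-η * c e)) (fun _ _ => (Real.exp_pos _).le)
      (Finset.mem_univ e)
  have hc : (0 : ℝ) < Fintype.card E := by exact_mod_cast Fintype.card_pos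
  have h2 := Real.log_le_log (Real.exp_pos _) h1
  rw [Real.log_exp] at h2
  rw [expPotential, Real.log_div (sum_exp_pos η c).ne' hc.ne']
  have : -(1 / η) * (Real.log (∑ e, Real.exp (-η * c e)) - Real.log (Fintype.card E)) =
      (-Real.log (∑ e, Real.exp (-η * c e)) + Real.log (Fintype.card E)) / η := by
    field_simp; ring
  rw [this, ← sub_nonneg]
  have e2 : c e + Real.log (Fintype.card E) / η -
      (-Real.log (∑ e, Real.exp (-η * c e)) + Real.log (Fintype.card E)) / η =
      (η * c e + Real.log (∑ e, Real.exp (-η * c e))) / η := by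
    field_simp; ring
  rw [e2]
  exact div_nonneg (by linarith) hη.le

theorem expPotential_add_ge (hη : 0 < η) (c g : E → ℝ) (hg : ∀ e, -η * g e ≤ 1) :
    ∑ e, expWeights η c e * g e - η * ∑ e, expWeights η c e * g e ^ 2 ≤
      expPotential η (fun e => c e + g e) - expPotential η c := by
  have hS := sum_exp_pos η c
  have hS' := sum_exp_pos η (fun e => c e + g e)
  have hc : (0 : ℝ) < Fintype.card E := by exact_mod_cast Fintype.card_pos
  have h1 : (∑ e, Real.exp (-η * (c e + g e))) / ∑ e, Real.exp (-η * c e) ≤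
      1 + (-η * ∑ e, expWeights η c e * g e + η ^ 2 * ∑ e, expWeights η c e * g e ^ 2) := by
    calc (∑ e, Real.exp (-η * (c e + g e))) / ∑ e, Real.exp (-η * c e)
        = ∑ e, expWeights η c e * Real.exp (-η * g e) := by
          rw [Finset.sum_div]
          refine Finset.sum_congr rfl fun e _ => ?_
          rw [mul_add, Real.exp_add, expWeights]; ring
      _ ≤ ∑ e, expWeights η c e * (1 + -η * g e + (-η * g e) ^ 2) :=
          Finset.sum_le_sum fun e _ => mul_le_mul_of_nonneg_left
            (exp_le_one_add_add_sq (hg e)) (expWeights_nonneg η c e)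
      _ = _ := by
          conv_rhs => rw [← sum_expWeights η c]
          rw [Finset.mul_sum, Finset.mul_sum, ← Finset.sum_add_distrib, ← Finset.sum_add_distrib]
          exact Finset.sum_congr rfl fun e _ => by ring
  have h2 := (Real.log_le_sub_one_of_pos (div_pos hS' hS)).trans
    (sub_le_sub_right h1 1)
  rw [Real.log_div hS'.ne' hS.ne'] at h2
  rw [expPotential, expPotential, Real.log_div hS'.ne' hc.ne', Real.log_div hS.ne' hc.ne']
  have e : -(1 / η) * (Real.log (∑ e, Real.exp (-η * (c e + g e))) - Real.log (Fintype.card E)) -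
      -(1 / η) * (Real.log (∑ e, Real.exp (-η * c e)) - Real.log (Fintype.card E)) =
      -(Real.log (∑ e, Real.exp (-η * (c e + g e))) - Real.log (∑ e, Real.exp (-η * c e))) / η := by
    field_simp; ring
  rw [e, le_div_iff₀ hη]
  nlinarith

end ExpWeights

/-! ### The regret of one round for a fixed action set -/

section OneStep

open Matrix

variable {d M : ℕ} {Θ : Type*} [Fintype Θ]

/-- The inverse covariance form of level `j` when experts are played according to `R`. -/
def levelForm (R : Fin M × Θ → ℝ) (x : Θ → Fin d → ℝ) (lam : ℝ) (j : Fin M)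
    (u v : Fin d → ℝ) : ℝ :=
  invForm (fun θ => R (j, θ)) x lam u v

/-- The importance weight of the played expert `e'` in the loss estimate of expert `e`. -/
def impWeight (R : Fin M × Θ → ℝ) (x : Θ → Fin d → ℝ) (lam : ℝ) (e e' : Fin M × Θ) : ℝ :=
  if e'.1 = e.1 then levelForm R x lam e.1 (x e.2) (x e'.2) else 0

/-- The bonus of expert `e`, which compensates for misspecification. -/
def bonus (α : Fin M → ℝ) (R : Fin M × Θ → ℝ) (x : Θ → Fin d → ℝ) (lam : ℝ)
    (e : Fin M × Θ) : ℝ :=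
  α e.1 * (8 * d - (∑ θ, R (e.1, θ)) * levelForm R x lam e.1 (x e.2) (x e.2))

/-- A lower bound for the progress of the exponential weights in terms of the played expert `e'`,
affine in the loss `l`. -/
def progressBound (η : ℝ) (α : Fin M → ℝ) (P R : Fin M × Θ → ℝ) (x : Θ → Fin d → ℝ) (lam : ℝ)
    (es e' : Fin M × Θ) (l : ℝ) : ℝ :=
  ∑ e, P e * (impWeight R x lam e e' * l + bonus α R x lam e)
    - 2 * η * ∑ e, P e * impWeight R x lam e e' ^ 2
    - 2 * η * ∑ e, P e * bonus α R x lam e ^ 2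
    - (impWeight R x lam es e' * l + bonus α R x lam es)

variable {R P : Fin M × Θ → ℝ} {x : Θ → Fin d → ℝ} {lam : ℝ}

/-- Importance weights vanish off the level of `e`, so any sum that vanishes with the weight reduces
to one level. -/
theorem sum_mul_impWeight (e : Fin M × Θ) (g : Fin M × Θ → ℝ → ℝ) (hg : ∀ e', g e' 0 = 0) :
    ∑ e', g e' (impWeight R x lam e e') =
      ∑ θ', g (e.1, θ') (levelForm R x lam e.1 (x e.2) (x θ')) := by
  rw [Fintype.sum_prod_type, Finset.sum_eq_single e.1]
  · simp [impWeight]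
  · intro j _ hj
    exact Finset.sum_eq_zero fun θ' _ => by simp [impWeight, hj, hg]
  · simp

theorem sum_mul_impWeight_sq_le (hR : ∀ e, 0 ≤ R e) (hl : 0 < lam) (e : Fin M × Θ) :
    ∑ e', R e' * impWeight R x lam e e' ^ 2 ≤ levelForm R x lam e.1 (x e.2) (x e.2) := by
  rw [sum_mul_impWeight e (fun e' t => R e' * t ^ 2) (by simp)]
  exact sum_mul_invForm_sq_le (fun θ => hR (e.1, θ)) hl _

theorem abs_sum_mul_impWeight_sub_le (hR : ∀ e, 0 ≤ R e) (hl : 0 < lam) {F : Θ → ℝ}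
    {y : Fin d → ℝ} {ε : ℝ} (hy : y ⬝ᵥ y ≤ 1) (hF : ∀ θ, |F θ - x θ ⬝ᵥ y| ≤ ε) (hε : 0 ≤ ε)
    (e : Fin M × Θ) :
    |∑ e', R e' * (impWeight R x lam e e' * F e'.2) - F e.2| ≤
      ε + √(lam * levelForm R x lam e.1 (x e.2) (x e.2))
        + ε * √((∑ θ, R (e.1, θ)) * levelForm R x lam e.1 (x e.2) (x e.2)) := by
  rw [sum_mul_impWeight e (fun e' t => R e' * (t * F e'.2)) (by simp)]
  have h1 := abs_sum_mul_invForm_sub_le (x := x) (fun θ => hR (e.1, θ)) hl (x e.2) y hy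
  have h2 := abs_sum_mul_invForm_le (x := x) (fun θ => hR (e.1, θ)) hl (x e.2)
    (fun θ => F θ - x θ ⬝ᵥ y) hF hε
  have h3 := hF e.2
  have e1 : ∑ θ', R (e.1, θ') * (levelForm R x lam e.1 (x e.2) (x θ') * F θ') =
      ∑ θ', R (e.1, θ') * invForm (fun θ => R (e.1, θ)) x lam (x e.2) (x θ') * (x θ' ⬝ᵥ y) +
      ∑ θ', R (e.1, θ') * invForm (fun θ => R (e.1, θ)) x lam (x e.2) (x θ') *
        (F θ' - x θ' ⬝ᵥ y) := by
    rw [← Finset.sum_add_distrib]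
    exact Finset.sum_congr rfl fun θ' _ => by rw [levelForm]; ring
  simp only [e1, levelForm] at *
  rw [abs_le] at *
  constructor <;> linarith

theorem sum_mul_levelForm_le (hR : ∀ e, 0 ≤ R e) (hl : 0 < lam) (j : Fin M) :
    ∑ θ, R (j, θ) * levelForm R x lam j (x θ) (x θ) ≤ d :=
  sum_mul_invForm_self_le (fun θ => hR (j, θ)) hl

theorem levelForm_self_nonneg (hR : ∀ e, 0 ≤ R e) (hl : 0 < lam) (j : Fin M) (u : Fin d → ℝ) :
    0 ≤ levelForm R x lam j u u :=
  invForm_self_nonneg (fun θ => hR (j, θ)) hl u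

variable {N : Fin M × Θ → ℝ} {F : Θ → ℝ} {α : Fin M → ℝ} {η γ : ℝ}

/-- The constant `8d` balances three costs. The second-order term uses `4d + q w` times `α`;
together with the subtracted `q w` this leaves `4d P - 2 P q w ≥ 4d P - 4 R q w`. Within a level `∑
R w ≤ d`, so the remainder is `4d (p_j - q_j) α_j`, where `p_j` is the level's mass under `P`, and
`q_j` exceeds `p_j` by at most `γ / M`. -/
theorem sum_mul_bonus_ge (hd : 1 ≤ d) (hR : ∀ e, 0 ≤ R e) (hl : 0 < lam) (hP : ∀ e, 0 ≤ P e)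
    (hPR : ∀ e, P e ≤ 2 * R e) (hR1 : ∑ e, R e = 1)
    (hq : ∀ j, ∑ θ, R (j, θ) ≤ ∑ θ, P (j, θ) + γ / M) (hγ : 0 ≤ γ)
    (hα : ∀ j, 0 ≤ α j) (hα1 : ∀ j, α j ≤ 1) (hη : 0 < η) (hηd : 32 * η * d ≤ 1)
    (hW : ∀ e : Fin M × Θ, levelForm R x lam e.1 (x e.2) (x e.2) ≤ 1 / (2 * η)) :
    -(4 * d * γ) ≤ ∑ e, P e * bonus α R x lam e - 2 * η * ∑ e, P e * bonus α R x lam e ^ 2 := by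
  have hd' : (1 : ℝ) ≤ d := by exact_mod_cast hd
  have hq0 : ∀ j, 0 ≤ ∑ θ, R (j, θ) := fun j => Finset.sum_nonneg fun θ _ => hR _
  have hq1 : ∀ j, ∑ θ, R (j, θ) ≤ 1 := fun j => by
    rw [← hR1, Fintype.sum_prod_type]
    exact Finset.single_le_sum (f := fun j => ∑ θ, R (j, θ)) (fun j _ => hq0 j)
      (Finset.mem_univ j)
  have hpt : ∀ e : Fin M × Θ, P e * (α e.1 * (4 * d)) - α e.1 * (∑ θ, R (e.1, θ)) *
      (4 * (R e * levelForm R x lam e.1 (x e.2) (x e.2))) ≤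
      P e * bonus α R x lam e - 2 * η * (P e * bonus α R x lam e ^ 2) := by
    intro e
    set w := levelForm R x lam e.1 (x e.2) (x e.2) with hw
    set q := ∑ θ, R (e.1, θ) with hqdef
    set a := α e.1
    have hw0 : 0 ≤ w := levelForm_self_nonneg hR hl _ _
    have hwη : 2 * η * w ≤ 1 := by
      have := hW e
      rw [le_div_iff₀ (by positivity)] at this
      linarith
    have ha0 := hα e.1
    have ha1 := hα1 e.1
    have hb : bonus α R x lam e = a * (8 * d - q * w) := rfl
    have hqw : 0 ≤ q * w := mul_nonneg (hq0 _) hw0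
    have hqwle : 2 * η * (q * w) ≤ 1 := by
      have : q * w ≤ w := by nlinarith [hq1 e.1]
      nlinarith
    have hsq : 2 * η * (a * (8 * d - q * w)) ^ 2 ≤ a * (4 * d + q * w) := by
      have h1 : (8 * d - q * w) ^ 2 ≤ 64 * (d : ℝ) ^ 2 + (q * w) * (q * w) := by nlinarith
      have h2 : 2 * η * (8 * d - q * w) ^ 2 ≤ 4 * d + q * w := by
        have h3 : 2 * η * (8 * d - q * w) ^ 2 ≤ 2 * η * (64 * (d : ℝ) ^ 2 + (q * w) * (q * w)) :=
          mul_le_mul_of_nonneg_left h1 (by positivity)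
        have h4 : 2 * η * (q * w) * (q * w) ≤ 1 * (q * w) := by gcongr
        have h5 : 32 * η * d * (4 * d) ≤ 1 * (4 * d) := by gcongr
        nlinarith
      have h6 : a * a ≤ a := by nlinarith
      have h7 : 0 ≤ 2 * η * (8 * d - q * w) ^ 2 := by positivity
      calc 2 * η * (a * (8 * d - q * w)) ^ 2 = a * a * (2 * η * (8 * d - q * w) ^ 2) := by ring
        _ ≤ a * (2 * η * (8 * d - q * w) ^ 2) := by gcongr
        _ ≤ _ := by gcongr
    have h8 : P e * (2 * η * (a * (8 * d - q * w)) ^ 2) ≤ P e * (a * (4 * d + q * w)) :=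
      mul_le_mul_of_nonneg_left hsq (hP e)
    have h9 : P e * (a * (q * w)) ≤ 2 * R e * (a * (q * w)) :=
      mul_le_mul_of_nonneg_right (hPR e) (mul_nonneg ha0 hqw)
    rw [hb]
    nlinarith
  have hsum := Finset.sum_le_sum fun e (_ : e ∈ Finset.univ) => hpt e
  rw [Finset.sum_sub_distrib, Finset.sum_sub_distrib, ← Finset.mul_sum] at hsum
  refine le_trans ?_ hsum
  rw [← Finset.sum_sub_distrib, Fintype.sum_prod_type]
  have hj : ∀ j, -(4 * d * (γ / M)) ≤ ∑ θ, (P (j, θ) * (α j * (4 * d)) - α j *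
      (∑ θ, R (j, θ)) * (4 * (R (j, θ) * levelForm R x lam j (x θ) (x θ)))) := by
    intro j
    rw [Finset.sum_sub_distrib, ← Finset.sum_mul, ← Finset.mul_sum, ← Finset.mul_sum]
    have h1 := sum_mul_levelForm_le (x := x) hR hl j
    have h2 : α j * (∑ θ, R (j, θ)) * (4 * ∑ θ, R (j, θ) * levelForm R x lam j (x θ) (x θ)) ≤
        α j * (∑ θ, P (j, θ) + γ / M) * (4 * d) := by
      have i1 := hα j
      have i2 := hq j
      have i3 := hq0 j
      have i4 : 0 ≤ ∑ θ, R (j, θ) * levelForm R x lam j (x θ) (x θ) :=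
        Finset.sum_nonneg fun θ _ => mul_nonneg (hR _) (levelForm_self_nonneg hR hl _ _)
      exact mul_le_mul (mul_le_mul_of_nonneg_left i2 i1) (by linarith) (by linarith)
        (mul_nonneg i1 (i3.trans i2))
    have h3 : α j * (γ / M * (4 * d)) ≤ 1 * (γ / M * (4 * d)) :=
      mul_le_mul_of_nonneg_right (hα1 j) (by positivity)
    nlinarith
  have := Finset.sum_le_sum fun j (_ : j ∈ Finset.univ) => hj j
  refine le_trans ?_ this
  simp only [Finset.sum_const, Finset.card_univ, Fintype.card_fin, nsmul_eq_mul]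
  rcases Nat.eq_zero_or_pos M with h0 | h0
  · subst h0; simp; positivity
  · have : (M : ℝ) ≠ 0 := by positivity
    field_simp
    rfl

set_option maxHeartbeats 1000000 in
/-- The one-round regret bound for exponential weights with misspecification bonus. -/
theorem regret_le_progressBound (hd : 1 ≤ d) (hl : 0 < lam) (hP : ∀ e, 0 ≤ P e)
    (hP1 : ∑ e, P e = 1) (hN : ∀ e, 0 ≤ N e) (hN1 : ∀ j, ∑ θ, N (j, θ) = 1 / M)
    (hM : 0 < M) (hγ : 0 ≤ γ) (hγ2 : γ ≤ 1 / 2) (hRdef : ∀ e, R e = (1 - γ) * P e + γ * N e)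
    (hα : ∀ j, 0 < α j) (hα1 : ∀ j, α j ≤ 1) (hη : 0 < η) (hηd : 32 * η * d ≤ 1)
    (hW : ∀ e : Fin M × Θ, levelForm R x lam e.1 (x e.2) (x e.2) ≤ 1 / (2 * η))
    {y : Fin d → ℝ} {ε : ℝ} (hy : y ⬝ᵥ y ≤ 1) (hF : ∀ θ, |F θ - x θ ⬝ᵥ y| ≤ ε) (hε : 0 ≤ ε)
    (hF1 : ∀ θ, |F θ| ≤ 1) (es : Fin M × Θ) :
    ∑ e, R e * F e.2 - F es.2 ≤
      ∑ e', R e' * progressBound η α P R x lam es e' (F e'.2)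
      + (6 * d * γ + 4 * η * d * M + 2 * √(lam / (2 * η))
        + (4 * √d) * ε + ε ^ 2 / (4 * α es.1) + 8 * d * α es.1) := by
  have hd' : (1 : ℝ) ≤ d := by exact_mod_cast hd
  have hM' : (0 : ℝ) < M := by exact_mod_cast hM
  have hNsum : ∑ e, N e = 1 := by
    rw [Fintype.sum_prod_type]; simp only [hN1]; simp; field_simp
  have hR : ∀ e, 0 ≤ R e := fun e => by
    rw [hRdef]
    exact add_nonneg (mul_nonneg (by linarith) (hP e)) (mul_nonneg hγ (hN e))
  have hR1 : ∑ e, R e = 1 := by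
    simp only [hRdef, Finset.sum_add_distrib, ← Finset.mul_sum, hP1, hNsum]; ring
  have hPR : ∀ e, P e ≤ 2 * R e := fun e => by
    rw [hRdef]; nlinarith [hP e, mul_nonneg hγ (hN e)]
  have hq : ∀ j, ∑ θ, R (j, θ) ≤ ∑ θ, P (j, θ) + γ / M := fun j => by
    simp only [hRdef, Finset.sum_add_distrib, ← Finset.mul_sum, hN1]
    have : 0 ≤ ∑ θ, P (j, θ) := Finset.sum_nonneg fun θ _ => hP _
    have h2 : γ * (1 / M) = γ / M := by ring
    nlinarith
  have hbon := sum_mul_bonus_ge (x := x) hd hR hl hP hPR hR1 hq hγ (fun j => (hα j).le) hα1 hη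
    hηd hW
  set w : Fin M × Θ → ℝ := fun e => levelForm R x lam e.1 (x e.2) (x e.2) with hw
  set q : Fin M → ℝ := fun j => ∑ θ, R (j, θ) with hqdef
  have hq0 : ∀ j, 0 ≤ q j := fun j => Finset.sum_nonneg fun θ _ => hR _
  have hw0 : ∀ e, 0 ≤ w e := fun e => levelForm_self_nonneg hR hl _ _
  -- `m` is the mean of the loss estimate under the play distribution; `s` dominates the ridge bias
  -- uniformly, by the width bound `hW`.
  set m : Fin M × Θ → ℝ := fun e => ∑ e', R e' * (impWeight R x lam e e' * F e'.2) with hm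
  set s := √(lam / (2 * η)) with hs
  have hms : ∀ e, |m e - F e.2| ≤ ε + s + ε * √(q e.1 * w e) := fun e => by
    refine (abs_sum_mul_impWeight_sub_le hR hl hy hF hε e).trans ?_
    gcongr
    refine Real.sqrt_le_sqrt ?_
    calc lam * levelForm R x lam e.1 (x e.2) (x e.2) ≤ lam * (1 / (2 * η)) := by
          gcongr; exact hW e
      _ = lam / (2 * η) := by ring
  have hexp : ∑ e', R e' * progressBound η α P R x lam es e' (F e'.2) =
      ∑ e, P e * m e - 2 * η * ∑ e, P e * ∑ e', R e' * impWeight R x lam e e' ^ 2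
      + (∑ e, P e * bonus α R x lam e - 2 * η * ∑ e, P e * bonus α R x lam e ^ 2)
      - m es - bonus α R x lam es := by
    have a1 : ∑ e, P e * m e = ∑ e', R e' * ∑ e, P e * (impWeight R x lam e e' * F e'.2) := by
      simp only [hm, Finset.mul_sum]
      rw [Finset.sum_comm]
      exact Finset.sum_congr rfl fun _ _ => Finset.sum_congr rfl fun _ _ => by ring
    have a2 : ∑ e, P e * ∑ e', R e' * impWeight R x lam e e' ^ 2 =
        ∑ e', R e' * ∑ e, P e * impWeight R x lam e e' ^ 2 := by
      simp only [Finset.mul_sum]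
      rw [Finset.sum_comm]
      exact Finset.sum_congr rfl fun _ _ => Finset.sum_congr rfl fun _ _ => by ring
    have a3 : ∀ t : ℝ, t = ∑ e', R e' * t := fun t => by rw [← Finset.sum_mul, hR1, one_mul]
    rw [a1, a2, a3 (∑ e, P e * bonus α R x lam e - 2 * η * ∑ e, P e * bonus α R x lam e ^ 2),
      a3 (bonus α R x lam es), hm, Finset.mul_sum, ← Finset.sum_sub_distrib,
      ← Finset.sum_add_distrib, ← Finset.sum_sub_distrib, ← Finset.sum_sub_distrib]
    refine Finset.sum_congr rfl fun e' _ => ?_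
    simp only [progressBound, mul_add, Finset.sum_add_distrib]
    ring
  -- Each level contributes at most `q_j d` and the level masses sum to one. Without the factor
  -- `q_j`, as in `hRw2` for the variance, the bound grows by the factor `M`.
  have hRw : ∑ e, R e * (q e.1 * w e) ≤ d := by
    rw [Fintype.sum_prod_type]
    have : ∀ j, ∑ θ, R (j, θ) * (q j * w (j, θ)) ≤ q j * d := fun j => by
      have := mul_le_mul_of_nonneg_left (sum_mul_levelForm_le (x := x) hR hl j) (hq0 j)
      rw [Finset.mul_sum] at this
      refine le_of_eq_of_le (Finset.sum_congr rfl fun θ _ => ?_) this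
      simp only [hw]; ring
    refine (Finset.sum_le_sum fun j _ => this j).trans ?_
    rw [← Finset.sum_mul]
    have : ∑ j, q j = 1 := by rw [← hR1, Fintype.sum_prod_type]
    rw [this, one_mul]
  have hRw2 : ∑ e, R e * w e ≤ d * M := by
    rw [Fintype.sum_prod_type]
    refine (Finset.sum_le_sum fun j _ => sum_mul_levelForm_le (x := x) hR hl j).trans ?_
    simp [mul_comm]
  have hsd : 0 < √(d : ℝ) := Real.sqrt_pos.2 (by linarith)
  have hsd2 : √(d : ℝ) * √(d : ℝ) = d := Real.mul_self_sqrt (by linarith)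
  have hsd1 : 1 ≤ √(d : ℝ) := Real.one_le_sqrt.2 hd'
  have hPsq : ∑ e, P e * √(q e.1 * w e) ≤ 3 / 2 * √d := by
    have hpt : ∀ e, P e * √(q e.1 * w e) ≤ P e * (√d / 2) + R e * (q e.1 * w e) / √d := by
      intro e
      have h0 : 0 ≤ q e.1 * w e := mul_nonneg (hq0 _) (hw0 _)
      have h1 : √(q e.1 * w e) ≤ √d / 2 + (q e.1 * w e) / √d / 2 := by
        have hss := Real.mul_self_sqrt h0
        have : 0 ≤ (√d - √(q e.1 * w e)) ^ 2 / √d / 2 := by positivity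
        have e2 : (√d - √(q e.1 * w e)) ^ 2 / √d / 2 =
            √d / 2 + (√(q e.1 * w e) * √(q e.1 * w e)) / √d / 2 - √(q e.1 * w e) := by
          field_simp; ring
        rw [e2, hss] at this
        linarith
      have h2 : P e * ((q e.1 * w e) / √d / 2) ≤ 2 * R e * ((q e.1 * w e) / √d / 2) :=
        mul_le_mul_of_nonneg_right (hPR e) (by positivity)
      have h3 := mul_le_mul_of_nonneg_left h1 (hP e)
      have h4 : 2 * R e * ((q e.1 * w e) / √d / 2) = R e * (q e.1 * w e) / √d := by ring
      linarith
    refine (Finset.sum_le_sum fun e _ => hpt e).trans ?_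
    rw [Finset.sum_add_distrib, ← Finset.sum_mul, ← Finset.sum_div, hP1]
    have : (∑ e, R e * (q e.1 * w e)) / √d ≤ √d := by
      rw [div_le_iff₀ hsd, hsd2]; exact hRw
    linarith
  have hPm : ∑ e, P e * F e.2 - ε - s - ε * (3 / 2 * √d) ≤ ∑ e, P e * m e := by
    have hpt : ∀ e, P e * F e.2 - P e * (ε + s) - ε * (P e * √(q e.1 * w e)) ≤ P e * m e := by
      intro e
      have := mul_le_mul_of_nonneg_left (abs_le.1 (hms e)).1 (hP e)
      nlinarith
    have := Finset.sum_le_sum fun e (_ : e ∈ Finset.univ) => hpt e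
    rw [Finset.sum_sub_distrib, Finset.sum_sub_distrib, ← Finset.sum_mul, ← Finset.mul_sum,
      hP1] at this
    have h2 := mul_le_mul_of_nonneg_left hPsq hε
    linarith
  have hPX : ∑ e, P e * ∑ e', R e' * impWeight R x lam e e' ^ 2 ≤ 2 * (d * M) := by
    calc _ ≤ ∑ e, 2 * (R e * w e) := by
          refine Finset.sum_le_sum fun e _ => ?_
          have h1 := sum_mul_impWeight_sq_le (x := x) hR hl e
          calc _ ≤ P e * w e := mul_le_mul_of_nonneg_left h1 (hP e)
            _ ≤ 2 * R e * w e := mul_le_mul_of_nonneg_right (hPR e) (hw0 e)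
            _ = _ := by ring
      _ ≤ _ := by rw [← Finset.mul_sum]; linarith
  -- The comparator's misspecification bias is split by AM–GM with weight `α`, and the term `α q w`
  -- is exactly the one subtracted by the bonus.
  have hstar : m es + bonus α R x lam es ≤ F es.2 + ε + s + ε ^ 2 / (4 * α es.1)
      + 8 * d * α es.1 := by
    have h1 := (abs_le.1 (hms es)).2
    have hb : bonus α R x lam es = α es.1 * (8 * d - q es.1 * w es) := rfl
    have h0 : 0 ≤ q es.1 * w es := mul_nonneg (hq0 _) (hw0 _)
    have ha := hα es.1
    have h2 : ε * √(q es.1 * w es) ≤ ε ^ 2 / (4 * α es.1) + α es.1 * (q es.1 * w es) := by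
      have hss := Real.mul_self_sqrt h0
      set t := √(q es.1 * w es)
      rw [← hss]
      have : 0 ≤ (ε - 2 * α es.1 * t) ^ 2 / (4 * α es.1) := by positivity
      have e2 : (ε - 2 * α es.1 * t) ^ 2 / (4 * α es.1) =
          ε ^ 2 / (4 * α es.1) + α es.1 * (t * t) - ε * t := by
        field_simp; ring
      linarith
    rw [hb]
    linarith
  have hexpl : ∑ e, R e * F e.2 ≤ ∑ e, P e * F e.2 + 2 * γ := by
    have hPF : -1 ≤ ∑ e, P e * F e.2 := by
      rw [← hP1, ← Finset.sum_neg_distrib]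
      refine Finset.sum_le_sum fun e _ => ?_
      nlinarith [hP e, (abs_le.1 (hF1 e.2)).1]
    have hNF : ∑ e, N e * F e.2 ≤ 1 := by
      rw [← hNsum]
      refine Finset.sum_le_sum fun e _ => ?_
      nlinarith [hN e, (abs_le.1 (hF1 e.2)).2]
    have e1 : ∑ e, R e * F e.2 = (1 - γ) * ∑ e, P e * F e.2 + γ * ∑ e, N e * F e.2 := by
      rw [Finset.mul_sum, Finset.mul_sum, ← Finset.sum_add_distrib]
      exact Finset.sum_congr rfl fun e _ => by rw [hRdef]; ring
    rw [e1]
    nlinarith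
  rw [hexp]
  have h1 : 2 * η * ∑ e, P e * ∑ e', R e' * impWeight R x lam e e' ^ 2 ≤ 2 * η * (2 * (d * M)) :=
    mul_le_mul_of_nonneg_left hPX (by positivity)
  have h2 : γ ≤ d * γ := by nlinarith
  have h3 : ε ≤ ε * √d := by nlinarith
  linarith

end OneStep

/-! ### The law of the interaction and conditional means -/

section Law

variable {d : ℕ} (L : Learner d) (env : Environment d L.Mem)

instance isMarkovKernel_stepKernel (t : ℕ) : IsMarkovKernel (stepKernel L env t) := by
  unfold stepKernel; infer_instance

theorem measurable_snoc {α : Type*} [MeasurableSpace α] (t : ℕ) :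
    Measurable (fun p : (Fin t → α) × α => Fin.snoc (α := fun _ => α) p.1 p.2) := by
  refine measurable_pi_lambda _ fun i => ?_
  refine Fin.lastCases ?_ (fun i => ?_) i
  · simpa using measurable_snd
  · simp only [Fin.snoc_castSucc]; fun_prop

instance isProbabilityMeasure_law (t : ℕ) : IsProbabilityMeasure (law L env t) := by
  induction t with
  | zero => unfold law; infer_instance
  | succ t ih => exact Measure.isProbabilityMeasure_map (measurable_snoc t).aemeasurable

/-- The rounds before round `t`. -/
def past {α : Type*} {T : ℕ} (h : Fin T → α) (t : Fin T) : Fin t → α :=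
  fun i => h (Fin.castLE t.isLt.le i)

theorem measurable_past {α : Type*} [MeasurableSpace α] {T : ℕ} (t : Fin T) :
    Measurable (fun h : Fin T → α => past h t) := by
  unfold past; fun_prop

/-- Consistency of the laws: later rounds do not change the joint law of round `t` and its past. -/
theorem law_map_past (T : ℕ) (t : Fin T) :
    (law L env T).map (fun h => (past h t, h t)) = law L env t ⊗ₘ stepKernel L env t := by
  induction T with
  | zero => exact t.elim0
  | succ T ih =>
    have hm : Measurable (fun h : Fin (T + 1) → Round d L.Mem env.State => (past h t, h t)) :=
      (measurable_past t).prodMk (measurable_pi_apply t)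
    rw [law, Measure.map_map hm (measurable_snoc T)]
    clear hm
    refine Fin.lastCases ?_ (fun t => ?_) t
    · have e : (fun h : Fin (T + 1) → Round d L.Mem env.State =>
          ((past h (Fin.last T), h (Fin.last T)) :
            (Fin T → Round d L.Mem env.State) × Round d L.Mem env.State)) ∘
          (fun p : (Fin T → Round d L.Mem env.State) × Round d L.Mem env.State =>
            Fin.snoc (α := fun _ => Round d L.Mem env.State) p.1 p.2) = id := by
        funext p
        refine Prod.ext ?_ ?_
        · funext i
          exact Fin.snoc_castSucc (α := fun _ => Round d L.Mem env.State) p.2 p.1 i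
        · simp
      exact (congrArg (fun f => Measure.map f (law L env T ⊗ₘ stepKernel L env T)) e).trans
        Measure.map_id
    · change _ = law L env t ⊗ₘ stepKernel L env t
      rw [← ih t]
      have e : (fun h : Fin (T + 1) → Round d L.Mem env.State =>
          (past h t.castSucc, h t.castSucc)) ∘
          (fun p : (Fin T → Round d L.Mem env.State) × Round d L.Mem env.State =>
            Fin.snoc (α := fun _ => Round d L.Mem env.State) p.1 p.2) =
          (fun h => (past h t, h t)) ∘ Prod.fst := by
        funext p
        refine Prod.ext ?_ ?_
        · funext i
          exact Fin.snoc_castSucc (α := fun _ => Round d L.Mem env.State) p.2 p.1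
            (Fin.castLE t.isLt.le i)
        · simp
      rw [e, ← Measure.map_map ((measurable_past t).prodMk (measurable_pi_apply t)) measurable_fst]
      congr 1
      exact Measure.fst_compProd _ _

/-- The conditional mean of a function of the past and the present round, given the past and the
hidden move of the environment. -/
def roundMean (t : ℕ)
    (φ : (Fin t → Round d L.Mem env.State) × Round d L.Mem env.State → ℝ)
    (h : Fin t → Round d L.Mem env.State) (s : env.State) : ℝ :=
  ∫ A, ∫ p, ∫ l, φ (h, (((s, A), p), l)) ∂(env.loss t (h, s, A, p.1))
    ∂(L.act t (fun i => (h i).obs, A)) ∂env.D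

variable {L env}

theorem abs_integral_le_of_bound {α : Type*} [MeasurableSpace α] {μ : Measure α}
    [IsProbabilityMeasure μ] {f : α → ℝ} {C : ℝ} (h : ∀ x, |f x| ≤ C) : |∫ x, f x ∂μ| ≤ C := by
  have := norm_integral_le_of_norm_le_const (μ := μ) (f := f) (C := C)
    (Filter.Eventually.of_forall fun x => by simpa using h x)
  simpa using this

theorem integrable_of_bound {α : Type*} [MeasurableSpace α] {μ : Measure α}
    [IsFiniteMeasure μ] {f : α → ℝ} {C : ℝ} (hm : Measurable f) (h : ∀ x, |f x| ≤ C) :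
    Integrable f μ :=
  Integrable.of_bound hm.aestronglyMeasurable C (Filter.Eventually.of_forall h)

section

variable {t : ℕ} {φ : (Fin t → Round d L.Mem env.State) × Round d L.Mem env.State → ℝ} {C : ℝ}

theorem measurable_integral_loss (hm : Measurable φ) :
    Measurable (fun x : (Fin t → Round d L.Mem env.State) ×
      ((env.State × Context d) × (Action d × L.Mem)) =>
      ∫ l, φ (x.1, (x.2, l)) ∂(env.loss t (x.1, x.2.1.1, x.2.1.2, x.2.2.1))) := by
  have h : StronglyMeasurable (fun z : ((Fin t → Round d L.Mem env.State) ×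
      ((env.State × Context d) × (Action d × L.Mem))) × ℝ => φ (z.1.1, (z.1.2, z.2))) :=
    (hm.comp (by fun_prop)).stronglyMeasurable
  exact (h.integral_kernel_prod_right'
    (κ := (env.loss t).comap _ (measurable_lossInput L env t))).measurable

theorem measurable_integral_act (hm : Measurable φ) :
    Measurable (fun x : (Fin t → Round d L.Mem env.State) × (env.State × Context d) =>
      ∫ p, ∫ l, φ (x.1, ((x.2, p), l)) ∂(env.loss t (x.1, x.2.1, x.2.2, p.1))
        ∂(L.act t (fun i => (x.1 i).obs, x.2.2))) := by
  have h : StronglyMeasurable (fun z : ((Fin t → Round d L.Mem env.State) ×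
      (env.State × Context d)) × (Action d × L.Mem) =>
      ∫ l, φ (z.1.1, ((z.1.2, z.2), l)) ∂(env.loss t (z.1.1, z.1.2.1, z.1.2.2, z.2.1))) :=
    ((measurable_integral_loss hm).comp
      (g := fun x : (Fin t → Round d L.Mem env.State) ×
        ((env.State × Context d) × (Action d × L.Mem)) =>
        ∫ l, φ (x.1, (x.2, l)) ∂(env.loss t (x.1, x.2.1.1, x.2.1.2, x.2.2.1)))
      (f := fun z : ((Fin t → Round d L.Mem env.State) ×
        (env.State × Context d)) × (Action d × L.Mem) => (z.1.1, (z.1.2, z.2)))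
      (by fun_prop)).stronglyMeasurable
  exact (h.integral_kernel_prod_right'
    (κ := (L.act t).comap _ (measurable_learnerInput L env t))).measurable

theorem measurable_roundMean (hm : Measurable φ) :
    Measurable (fun x : (Fin t → Round d L.Mem env.State) × env.State =>
      roundMean L env t φ x.1 x.2) := by
  have h : StronglyMeasurable (fun z : ((Fin t → Round d L.Mem env.State) × env.State) ×
      Context d => ∫ p, ∫ l, φ (z.1.1, (((z.1.2, z.2), p), l))
        ∂(env.loss t (z.1.1, z.1.2, z.2, p.1)) ∂(L.act t (fun i => (z.1.1 i).obs, z.2))) :=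
    ((measurable_integral_act hm).comp
      (g := fun x : (Fin t → Round d L.Mem env.State) × (env.State × Context d) =>
      ∫ p, ∫ l, φ (x.1, ((x.2, p), l)) ∂(env.loss t (x.1, x.2.1, x.2.2, p.1))
        ∂(L.act t (fun i => (x.1 i).obs, x.2.2)))
      (f := fun z : ((Fin t → Round d L.Mem env.State) × env.State) × Context d =>
        (z.1.1, (z.1.2, z.2)))
      (by fun_prop)).stronglyMeasurable
  exact (h.integral_prod_right' (ν := env.D)).measurable

theorem abs_roundMean_le (hC : ∀ x, |φ x| ≤ C) (h : Fin t → Round d L.Mem env.State)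
    (s : env.State) : |roundMean L env t φ h s| ≤ C :=
  abs_integral_le_of_bound fun _ => abs_integral_le_of_bound fun _ =>
    abs_integral_le_of_bound fun _ => hC _

theorem integral_stepKernel (hm : Measurable φ) (hC : ∀ x, |φ x| ≤ C)
    (h : Fin t → Round d L.Mem env.State) :
    ∫ r, φ (h, r) ∂(stepKernel L env t h) = ∫ s, roundMean L env t φ h s ∂(env.move t h) := by
  have hm1 : Measurable (fun x : (env.State × Context d) × (Action d × L.Mem) =>
      ∫ l, φ (h, (x, l)) ∂(env.loss t (h, x.1.1, x.1.2, x.2.1))) :=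
    (measurable_integral_loss hm).comp (measurable_const.prodMk measurable_id)
  have hm2 : Measurable (fun x : env.State × Context d =>
      ∫ p, ∫ l, φ (h, ((x, p), l)) ∂(env.loss t (h, x.1, x.2, p.1))
        ∂(L.act t (fun i => (h i).obs, x.2))) :=
    (measurable_integral_act hm).comp (measurable_const.prodMk measurable_id)
  have hm0 : Measurable (fun r : Round d L.Mem env.State => φ (h, r)) :=
    hm.comp (measurable_const.prodMk measurable_id)
  rw [stepKernel, integral_compProd (integrable_of_bound hm0 fun _ => hC _)]
  simp only [Kernel.comap_apply]
  rw [integral_compProd (integrable_of_bound hm1 fun _ => abs_integral_le_of_bound fun _ => hC _)]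
  simp only [Kernel.comap_apply]
  rw [integral_compProd (integrable_of_bound hm2 fun _ => abs_integral_le_of_bound fun _ =>
    abs_integral_le_of_bound fun _ => hC _)]
  simp only [Kernel.const_apply, roundMean]

/-- The tower property: in the mean, a function of a round may be replaced by its conditional mean
given the past and the hidden move. -/
theorem integral_law_eq {T : ℕ} (t : Fin T)
    {φ : (Fin t → Round d L.Mem env.State) × Round d L.Mem env.State → ℝ}
    (hm : Measurable φ) (hC : ∀ x, |φ x| ≤ C) :
    ∫ h, φ (past h t, h t) ∂(law L env T) =
      ∫ h, roundMean L env t φ (past h t) (h t).state ∂(law L env T) := by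
  have hpm : Measurable (fun h : Fin T → Round d L.Mem env.State => (past h t, h t)) :=
    (measurable_past t).prodMk (measurable_pi_apply t)
  have key : ∀ ψ : (Fin t → Round d L.Mem env.State) × Round d L.Mem env.State → ℝ,
      Measurable ψ → (∀ x, |ψ x| ≤ C) → ∫ h, ψ (past h t, h t) ∂(law L env T) =
        ∫ h, ∫ s, roundMean L env t ψ h s ∂(env.move t h) ∂(law L env t) := by
    intro ψ hψ hψC
    rw [← integral_map (f := ψ) hpm.aemeasurable hψ.aestronglyMeasurable, law_map_past,
      Measure.integral_compProd (integrable_of_bound hψ hψC)]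
    simp only [integral_stepKernel hψ hψC]
  have hst : Measurable (fun r : Round d L.Mem env.State => r.state) := by
    unfold Round.state; fun_prop
  -- The conditional mean depends on the current round only through its hidden move, so its own
  -- conditional mean is itself, and both sides have the same iterated integral.
  rw [key φ hm hC, key (fun x => roundMean L env t φ x.1 x.2.state)
    ((measurable_roundMean hm).comp (measurable_fst.prodMk (hst.comp measurable_snd)))
    fun x => abs_roundMean_le hC _ _]
  refine integral_congr_ae (Filter.Eventually.of_forall fun h => ?_)
  refine integral_congr_ae (Filter.Eventually.of_forall fun s => ?_)
  conv_rhs => simp only [roundMean, Round.state]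
  simp [roundMean]

theorem integral_law_sum_eq {T : ℕ}
    (φ : (t : Fin T) → (Fin t → Round d L.Mem env.State) × Round d L.Mem env.State → ℝ)
    (hm : ∀ t, Measurable (φ t)) (hC : ∀ t x, |φ t x| ≤ C) :
    ∫ h, ∑ t : Fin T, φ t (past h t, h t) ∂(law L env T) =
      ∫ h, ∑ t : Fin T, roundMean L env t (φ t) (past h t) (h t).state ∂(law L env T) := by
  have hst : Measurable (fun r : Round d L.Mem env.State => r.state) := by
    unfold Round.state; fun_prop
  rw [integral_finsetSum, integral_finsetSum]
  · exact Finset.sum_congr rfl fun t _ => integral_law_eq t (hm t) (hC t)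
  · intro t _
    exact integrable_of_bound ((measurable_roundMean (hm t)).comp
      ((measurable_past t).prodMk (hst.comp (measurable_pi_apply t))))
      fun _ => abs_roundMean_le (hC t) _ _
  · intro t _
    exact integrable_of_bound ((hm t).comp ((measurable_past t).prodMk (measurable_pi_apply t)))
      fun _ => hC t _

end

end Law

/-! ### Measurability of the inverse form -/

section Measurability

variable {X : Type*} [MeasurableSpace X] {d : ℕ} {ι : Type*} [Fintype ι]

-- By Cramer's rule each entry is `det⁻¹` times an entry of the adjugate; with `0⁻¹ = 0` this also
-- covers singular matrices.
open Matrix in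
theorem measurable_inv_apply (i j : Fin d) :
    Measurable (fun B : Fin d → Fin d → ℝ => (Matrix.of B)⁻¹ i j) := by
  have h1 : Continuous (fun B : Fin d → Fin d → ℝ => (Matrix.of B).det) :=
    Continuous.matrix_det continuous_id
  have h2 : Continuous (fun B : Fin d → Fin d → ℝ => (Matrix.of B).adjugate i j) :=
    (Continuous.matrix_adjugate continuous_id).matrix_elem i j
  have e : (fun B : Fin d → Fin d → ℝ => (Matrix.of B)⁻¹ i j) =
      fun B => ((Matrix.of B).det)⁻¹ * (Matrix.of B).adjugate i j := by
    funext B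
    rw [Matrix.inv_def, Ring.inverse_eq_inv', Matrix.smul_apply, smul_eq_mul]
  rw [e]
  exact h1.measurable.inv.mul h2.measurable

theorem measurable_invForm {p : X → ι → ℝ} {x : X → ι → Fin d → ℝ} {lam : ℝ}
    {u v : X → Fin d → ℝ} (hp : ∀ i, Measurable (fun a => p a i))
    (hx : ∀ i k, Measurable (fun a => x a i k)) (hu : ∀ k, Measurable (fun a => u a k))
    (hv : ∀ k, Measurable (fun a => v a k)) :
    Measurable (fun a => invForm (p a) (x a) lam (u a) (v a)) := by
  have hg : Measurable (fun a => (fun i j => gram (p a) (x a) lam i j : Fin d → Fin d → ℝ)) := by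
    refine measurable_pi_lambda _ fun i => measurable_pi_lambda _ fun j => ?_
    simp only [gram, Matrix.add_apply, Matrix.sum_apply, Matrix.smul_apply, Matrix.vecMulVec_apply,
      smul_eq_mul]
    refine (Finset.measurable_fun_sum _ fun k _ => ?_).add measurable_const
    exact (hp k).mul ((hx k i).mul (hx k j))
  have hi : ∀ i j, Measurable (fun a => (gram (p a) (x a) lam)⁻¹ i j) := fun i j =>
    (measurable_inv_apply i j).comp hg
  simp only [invForm, dotProduct, Matrix.mulVec]
  exact Finset.measurable_fun_sum _ fun i _ => (hu i).mul
    (Finset.measurable_fun_sum _ fun j _ => (hi i j).mul (hv j))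

end Measurability

/-! ### The learning algorithm -/

/-- Truncation to `[-1,1]`. -/
def clip (l : ℝ) : ℝ := max (-1) (min 1 l)

theorem measurable_clip : Measurable clip := by unfold clip; fun_prop

theorem abs_clip_le (l : ℝ) : |clip l| ≤ 1 :=
  abs_le.2 ⟨le_max_left _ _, max_le (by norm_num) (min_le_left _ _)⟩

theorem clip_of_mem {l : ℝ} (hl : l ∈ Set.Icc (-1 : ℝ) 1) : clip l = l := by
  rw [clip, min_eq_right hl.2, max_eq_right hl.1]

/-- The parameters of the learning algorithm. -/
structure Params (d : ℕ) where
  one_le_dim : 1 ≤ d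
  mesh : ℕ
  levels : ℕ
  levels_pos : 0 < levels
  rate : ℝ
  explore : ℝ
  explore_nonneg : 0 ≤ explore
  explore_le : explore ≤ 1 / 2
  reg : ℝ
  reg_pos : 0 < reg
  scale : Fin levels → ℝ

namespace Params

variable {d : ℕ} (S : Params d)

/-- Indices of a grid in the cube `[-1,1]^d`. -/
abbrev Net : Type := Fin d → Fin (2 * S.mesh + 1)

/-- An expert is a bonus level together with a grid point. -/
abbrev Expert : Type := Fin S.levels × S.Net

instance : Nonempty S.Expert := ⟨⟨⟨0, S.levels_pos⟩, fun _ => 0⟩⟩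

def gridPoint (θ : S.Net) : Action d :=
  WithLp.toLp 2 fun i => ((θ i : ℕ) - (S.mesh : ℝ)) / S.mesh

/-- The action which the linear policy of a grid point takes. -/
def feat (A : Context d) (θ : S.Net) : Action d := linPolicy (S.gridPoint θ) A

def featVec (A : Context d) (θ : S.Net) : Fin d → ℝ := (S.feat A θ).ofLp

theorem measurable_feat (θ : S.Net) : Measurable (fun A => S.feat A θ) :=
  measurable_linPolicy _

theorem measurable_featVec (θ : S.Net) (k : Fin d) : Measurable (fun A => S.featVec A θ k) := by
  have h : Continuous (fun a : Action d => a.ofLp k) := by fun_prop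
  exact h.measurable.comp (S.measurable_feat θ)

/-- There are finitely many candidate designs and each is good on a measurable set of contexts; the
first good one in an enumeration depends measurably on the context. -/
theorem exists_measurable_design :
    ∃ τ : Context d → Fin (2 * d) → S.Net, Measurable τ ∧ ∀ A θ,
      invForm (fun _ => 1) (fun k => S.featVec A (τ A k)) S.reg (S.featVec A θ) (S.featVec A θ)
        ≤ 1 := by
  classical
  let good : Context d → (Fin (2 * d) → S.Net) → Prop := fun A τ => ∀ θ,
    invForm (fun _ => 1) (fun k => S.featVec A (τ k)) S.reg (S.featVec A θ) (S.featVec A θ) ≤ 1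
  have hgood : ∀ τ, MeasurableSet {A | good A τ} := fun τ => by
    have : {A | good A τ} = ⋂ θ, {A | invForm (fun _ => 1) (fun k => S.featVec A (τ k)) S.reg
        (S.featVec A θ) (S.featVec A θ) ≤ 1} := by
      ext A; simp [good]
    rw [this]
    refine MeasurableSet.iInter fun θ => measurableSet_le ?_ measurable_const
    exact measurable_invForm (fun _ => measurable_const)
      (fun k i => S.measurable_featVec (τ k) i) (S.measurable_featVec θ) (S.measurable_featVec θ)
  let enc := Encodable.ofCountable (Fin (2 * d) → S.Net)
  let p : Context d → ℕ → Prop := fun A n => ∃ τ, enc.decode n = some τ ∧ good A τ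
  have hp : ∀ A, ∃ n, p A n := fun A => by
    obtain ⟨τ, hτ⟩ := exists_design S.one_le_dim S.reg_pos (S.featVec A)
    exact ⟨enc.encode τ, τ, enc.encodek τ, hτ⟩
  have hpm : ∀ n, MeasurableSet {A | p A n} := fun n => by
    rcases hn : enc.decode n with _ | τ
    · simp [p, hn]
    · simpa [p, hn] using hgood τ
  have hfind := measurable_find hp hpm
  let τ₀ : Fin (2 * d) → S.Net := fun _ _ => 0
  refine ⟨fun A => (enc.decode (Nat.find (hp A))).getD τ₀,
    (Measurable.of_discrete (f := fun n : ℕ => (enc.decode n).getD τ₀)).comp hfind,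
    fun A => ?_⟩
  obtain ⟨τ, h1, h2⟩ := Nat.find_spec (hp A)
  simp only [h1, Option.getD_some]
  exact h2

/-- An approximately optimal design among the actions of the linear policies. -/
def design : Context d → Fin (2 * d) → S.Net := S.exists_measurable_design.choose

theorem measurable_design : Measurable S.design := S.exists_measurable_design.choose_spec.1

theorem invForm_design_le (A : Context d) (θ : S.Net) :
    invForm (fun _ => 1) (fun k => S.featVec A (S.design A k)) S.reg (S.featVec A θ)
      (S.featVec A θ) ≤ 1 :=
  S.exists_measurable_design.choose_spec.2 A θ

/-- The exploration distribution. -/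
def exploreDist (A : Context d) (e : S.Expert) : ℝ :=
  1 / S.levels * ((∑ k, if S.design A k = e.2 then (1 : ℝ) else 0) / (2 * d))

theorem measurable_exploreDist (e : S.Expert) : Measurable (fun A => S.exploreDist A e) :=
  (Measurable.of_discrete (f := fun τ : Fin (2 * d) → S.Net =>
    1 / (S.levels : ℝ) * ((∑ k, if τ k = e.2 then (1 : ℝ) else 0) / (2 * d)))).comp
    S.measurable_design

theorem exploreDist_nonneg (A : Context d) (e : S.Expert) : 0 ≤ S.exploreDist A e := by
  unfold exploreDist
  have : 0 ≤ ∑ k, if S.design A k = e.2 then (1 : ℝ) else 0 :=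
    Finset.sum_nonneg fun k _ => by split_ifs <;> norm_num
  positivity

theorem sum_exploreDist (A : Context d) (j : Fin S.levels) :
    ∑ θ, S.exploreDist A (j, θ) = 1 / S.levels := by
  have hd : (d : ℝ) ≠ 0 := by have := S.one_le_dim; positivity
  simp only [exploreDist]
  rw [← Finset.mul_sum, ← Finset.sum_div, Finset.sum_comm]
  simp
  field_simp

/-- The distribution over experts which is played for the cumulative losses `c`. -/
def play (c : S.Expert → ℝ) (A : Context d) (e : S.Expert) : ℝ :=
  (1 - S.explore) * expWeights S.rate c e + S.explore * S.exploreDist A e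

theorem play_nonneg (c : S.Expert → ℝ) (A : Context d) (e : S.Expert) : 0 ≤ S.play c A e :=
  add_nonneg (mul_nonneg (by linarith [S.explore_le]) (expWeights_nonneg _ _ _))
    (mul_nonneg S.explore_nonneg (S.exploreDist_nonneg A e))

theorem sum_play (c : S.Expert → ℝ) (A : Context d) : ∑ e, S.play c A e = 1 := by
  have hM : (S.levels : ℝ) ≠ 0 := by have := S.levels_pos; positivity
  have h : ∑ e, S.exploreDist A e = 1 := by
    rw [Fintype.sum_prod_type]
    simp only [S.sum_exploreDist]
    simp [hM]
  simp only [play, Finset.sum_add_distrib, ← Finset.mul_sum, sum_expWeights, h]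
  ring

theorem measurable_play (e : S.Expert) :
    Measurable (fun x : (S.Expert → ℝ) × Context d => S.play x.1 x.2 e) := by
  have h1 : Measurable (fun c : S.Expert → ℝ => expWeights S.rate c e) := by
    unfold expWeights
    fun_prop
  exact ((h1.comp measurable_fst).const_mul _).add
    (((S.measurable_exploreDist e).comp measurable_snd).const_mul _)

/-- The estimated loss of expert `e` when expert `e'` has been played and the loss `l` has been
received. -/
def estLoss (c : S.Expert → ℝ) (A : Context d) (e' : S.Expert) (l : ℝ) (e : S.Expert) : ℝ :=
  impWeight (S.play c A) (S.featVec A) S.reg e e' * clip l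
    + bonus S.scale (S.play c A) (S.featVec A) S.reg e

theorem measurable_impWeight (e e' : S.Expert) :
    Measurable (fun x : (S.Expert → ℝ) × Context d =>
      impWeight (S.play x.1 x.2) (S.featVec x.2) S.reg e e') := by
  unfold impWeight
  split_ifs
  · exact measurable_invForm (fun i => S.measurable_play _)
      (fun i k => (S.measurable_featVec i k).comp measurable_snd)
      (fun k => (S.measurable_featVec _ k).comp measurable_snd)
      (fun k => (S.measurable_featVec _ k).comp measurable_snd)
  · exact measurable_const

theorem measurable_bonus (e : S.Expert) :
    Measurable (fun x : (S.Expert → ℝ) × Context d =>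
      bonus S.scale (S.play x.1 x.2) (S.featVec x.2) S.reg e) := by
  unfold bonus
  refine measurable_const.mul (measurable_const.sub (Measurable.mul ?_ ?_))
  · exact Finset.measurable_fun_sum _ fun θ _ => S.measurable_play _
  · exact measurable_invForm (fun i => S.measurable_play _)
      (fun i k => (S.measurable_featVec i k).comp measurable_snd)
      (fun k => (S.measurable_featVec _ k).comp measurable_snd)
      (fun k => (S.measurable_featVec _ k).comp measurable_snd)

theorem measurable_estLoss (e : S.Expert) :
    Measurable (fun x : (((S.Expert → ℝ) × Context d) × ℝ) × S.Expert =>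
      S.estLoss x.1.1.1 x.1.1.2 x.2 x.1.2 e) := by
  refine measurable_from_prod_countable_left fun e' => ?_
  have h0 : Measurable (Prod.fst : ((S.Expert → ℝ) × Context d) × ℝ → _) := measurable_fst
  have h1 := (S.measurable_impWeight e e').comp h0
  have h2 := (S.measurable_bonus e).comp h0
  exact (h1.mul (measurable_clip.comp measurable_snd)).add h2

/-- The cumulative estimated losses of the experts. -/
def cumLoss : (t : ℕ) → (Fin t → Obs d S.Expert) → S.Expert → ℝ
  | 0, _ => fun _ => 0
  | t + 1, h => fun e => cumLoss t (fun i => h i.castSucc) e +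
      S.estLoss (cumLoss t (fun i => h i.castSucc)) (h (Fin.last t)).1 (h (Fin.last t)).2.1.2
        (h (Fin.last t)).2.2 e

theorem measurable_cumLoss (t : ℕ) : Measurable (S.cumLoss t) := by
  induction t with
  | zero => exact measurable_const
  | succ t ih =>
    refine measurable_pi_lambda _ fun e => ?_
    have h1 : Measurable (fun h : Fin (t + 1) → Obs d S.Expert =>
        S.cumLoss t (fun i => h i.castSucc)) := ih.comp (by fun_prop)
    refine ((measurable_pi_apply e).comp h1).add ?_
    refine (S.measurable_estLoss e).comp (((h1.prodMk ?_).prodMk ?_).prodMk ?_) <;> fun_prop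

/-- The law of the action and of the expert of round `t`. -/
def actKernel (t : ℕ) :
    Kernel ((Fin t → Obs d S.Expert) × Context d) (Action d × S.Expert) where
  toFun x := ∑ e, ENNReal.ofReal (S.play (S.cumLoss t x.1) x.2 e) •
    Measure.dirac (S.feat x.2 e.2, e)
  measurable' := by
    refine Measure.measurable_of_measurable_coe _ fun s hs => ?_
    simp only [Measure.finsetSum_apply, Measure.smul_apply, smul_eq_mul, Measure.dirac_apply' _ hs]
    refine Finset.measurable_fun_sum _ fun e _ => Measurable.mul ?_ ?_
    · exact ENNReal.measurable_ofReal.comp ((S.measurable_play e).comp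
        (((S.measurable_cumLoss t).comp measurable_fst).prodMk measurable_snd))
    · refine (measurable_const.indicator hs).comp ?_
      exact ((S.measurable_feat e.2).comp measurable_snd).prodMk measurable_const

theorem actKernel_apply (t : ℕ) (x : (Fin t → Obs d S.Expert) × Context d) :
    S.actKernel t x = ∑ e, ENNReal.ofReal (S.play (S.cumLoss t x.1) x.2 e) •
      Measure.dirac (S.feat x.2 e.2, e) := rfl

instance (t : ℕ) : IsMarkovKernel (S.actKernel t) where
  isProbabilityMeasure x := ⟨by
    simp only [actKernel_apply, Measure.finsetSum_apply, Measure.smul_apply, smul_eq_mul,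
      measure_univ, mul_one]
    rw [← ENNReal.ofReal_sum_of_nonneg fun e _ => S.play_nonneg _ _ e, S.sum_play,
      ENNReal.ofReal_one]⟩

theorem ae_actKernel (t : ℕ) (x : (Fin t → Obs d S.Expert) × Context d)
    {p : Action d × S.Expert → Prop} (hp : ∀ e, p (S.feat x.2 e.2, e))
    (hm : MeasurableSet {z | p z}) : ∀ᵐ z ∂(S.actKernel t x), p z := by
  rw [ae_iff, actKernel_apply, Measure.finsetSum_apply]
  refine Finset.sum_eq_zero fun e _ => ?_
  have hm' : MeasurableSet {z | ¬p z} := hm.compl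
  rw [Measure.smul_apply, Measure.dirac_apply' _ hm']
  simp [hp e]

theorem integral_actKernel (t : ℕ) (x : (Fin t → Obs d S.Expert) × Context d)
    {g : Action d × S.Expert → ℝ} (hg : Measurable g) :
    ∫ z, g z ∂(S.actKernel t x) =
      ∑ e, S.play (S.cumLoss t x.1) x.2 e * g (S.feat x.2 e.2, e) := by
  rw [actKernel_apply, integral_finsetSum_measure]
  · refine Finset.sum_congr rfl fun e _ => ?_
    rw [integral_smul_measure, integral_dirac' _ _ hg.stronglyMeasurable,
      ENNReal.toReal_ofReal (S.play_nonneg _ _ e), smul_eq_mul]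
  · intro e _
    refine Integrable.smul_measure ?_ ENNReal.ofReal_ne_top
    exact (integrable_const (g (S.feat x.2 e.2, e))).congr
      ((ae_eq_dirac' hg).symm)

/-- The learning algorithm: exponential weights over linear policies and bonus levels. -/
abbrev learner : Learner d where
  -- The action alone does not reveal which expert was played, nor its level. The estimates need
  -- both, so the played expert is kept as memory.
  Mem := S.Expert
  act := S.actKernel
  act_mem t h A := S.ae_actKernel t (h, A) (fun _ => linPolicy_mem _ _)
    (A.1.isCompact.isClosed.measurableSet.preimage measurable_fst)

end Params

/-! ### Sizes of the loss estimates and the pathwise bound for exponential weights -/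

namespace Params

variable {d : ℕ} (S : Params d)

/-- The conditions on the parameters under which the regret bound is proved. -/
structure Admissible : Prop where
  rate_pos : 0 < S.rate
  rate_mul_dim_le : 32 * S.rate * d ≤ 1
  le_explore : 4 * S.rate * d * S.levels ≤ S.explore
  scale_pos : ∀ j, 0 < S.scale j
  scale_le_one : ∀ j, S.scale j ≤ 1

variable {S}

/-- Exploration alone puts on each level at least `c₀ = γ / (2dM)` times the design covariance,
whose widths are at most `1`. Hence widths are at most `1 / c₀`, and `γ ≥ 4 η d M` turns this into
`1 / (2η)`. -/
theorem levelForm_le (hS : S.Admissible) (c : S.Expert → ℝ) (A : Context d) (e : S.Expert) :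
    levelForm (S.play c A) (S.featVec A) S.reg e.1 (S.featVec A e.2) (S.featVec A e.2)
      ≤ 1 / (2 * S.rate) := by
  have hη := hS.rate_pos
  have hd : (1 : ℝ) ≤ d := by exact_mod_cast S.one_le_dim
  have hM : (1 : ℝ) ≤ S.levels := by exact_mod_cast S.levels_pos
  have hγ : 0 < S.explore := lt_of_lt_of_le (by positivity) hS.le_explore
  set c₀ : ℝ := S.explore / (2 * d * S.levels) with hc₀
  have hc₀pos : 0 < c₀ := by positivity
  have hc₀le : c₀ ≤ 1 := by
    rw [hc₀, div_le_one (by positivity)]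
    have := S.explore_le
    nlinarith
  have key := invForm_le_of_quadratic_le (p := fun θ => S.play c A (e.1, θ)) (x := S.featVec A)
    (p' := fun _ : Fin (2 * d) => (1 : ℝ)) (x' := fun k => S.featVec A (S.design A k))
    (lam' := S.reg) (c := c₀) (fun θ => S.play_nonneg c A _) S.reg_pos (fun _ => zero_le_one)
    S.reg_pos hc₀pos ?_ (S.featVec A e.2)
  · refine key.trans ((div_le_div_of_nonneg_right (S.invForm_design_le A e.2) hc₀pos.le).trans ?_)
    rw [hc₀, one_div_div, div_le_div_iff₀ hγ (by positivity)]
    nlinarith [hS.le_explore]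
  · intro v
    have h1 : ∑ k, c₀ * (S.featVec A (S.design A k) ⬝ᵥ v) ^ 2 ≤
        ∑ θ, S.play c A (e.1, θ) * (S.featVec A θ ⬝ᵥ v) ^ 2 := by
      calc ∑ k, c₀ * (S.featVec A (S.design A k) ⬝ᵥ v) ^ 2
          = ∑ k, ∑ θ, (if S.design A k = θ then c₀ else 0) * (S.featVec A θ ⬝ᵥ v) ^ 2 := by
            refine Finset.sum_congr rfl fun k _ => ?_
            simp [ite_mul]
        _ = ∑ θ, S.explore * S.exploreDist A (e.1, θ) * (S.featVec A θ ⬝ᵥ v) ^ 2 := by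
            rw [Finset.sum_comm]
            refine Finset.sum_congr rfl fun θ _ => ?_
            rw [← Finset.sum_mul]
            congr 1
            rw [exploreDist, Finset.sum_div, Finset.mul_sum, Finset.mul_sum]
            refine Finset.sum_congr rfl fun k _ => ?_
            split_ifs
            · rw [hc₀]; field_simp
            · simp
        _ ≤ _ := by
            refine Finset.sum_le_sum fun θ _ => mul_le_mul_of_nonneg_right ?_ (sq_nonneg _)
            rw [play]
            have := mul_nonneg (by linarith [S.explore_le] : 0 ≤ 1 - S.explore)
              (expWeights_nonneg S.rate c (e.1, θ))
            linarith
    have h2 : 0 ≤ S.reg * (v ⬝ᵥ v) :=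
      mul_nonneg S.reg_pos.le (by simpa using dotProduct_star_self_nonneg v)
    rw [mul_add, Finset.mul_sum]
    simp only [one_mul]
    nlinarith

theorem abs_impWeight_le (hS : S.Admissible) (c : S.Expert → ℝ) (A : Context d)
    (e e' : S.Expert) :
    |impWeight (S.play c A) (S.featVec A) S.reg e e'| ≤ 1 / (2 * S.rate) := by
  have hη := hS.rate_pos
  unfold impWeight
  split_ifs with h
  · refine abs_le_of_sq_le_sq ?_ (by positivity)
    have h1 := levelForm_le hS c A e
    have h2 := levelForm_le hS c A (e.1, e'.2)
    have h3 := invForm_sq_le (x := S.featVec A) (fun θ => S.play_nonneg c A (e.1, θ)) S.reg_pos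
      (S.featVec A e.2) (S.featVec A e'.2)
    refine h3.trans ?_
    rw [sq]
    exact mul_le_mul h1 h2 (invForm_self_nonneg (fun θ => S.play_nonneg c A _) S.reg_pos _)
      (by positivity)
  · simp only [abs_zero]; positivity

theorem bonus_mem (hS : S.Admissible) (c : S.Expert → ℝ) (A : Context d) (e : S.Expert) :
    bonus S.scale (S.play c A) (S.featVec A) S.reg e ∈ Set.Icc (-(1 / (2 * S.rate))) (8 * d) := by
  have hη := hS.rate_pos
  have hw := levelForm_le hS c A e
  have hw0 := levelForm_self_nonneg (x := S.featVec A) (S.play_nonneg c A) S.reg_pos e.1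
    (S.featVec A e.2)
  have hq0 : 0 ≤ ∑ θ, S.play c A (e.1, θ) := Finset.sum_nonneg fun θ _ => S.play_nonneg c A _
  have hq1 : ∑ θ, S.play c A (e.1, θ) ≤ 1 := by
    rw [← S.sum_play c A, Fintype.sum_prod_type]
    exact Finset.single_le_sum (f := fun j => ∑ θ, S.play c A (j, θ))
      (fun j _ => Finset.sum_nonneg fun θ _ => S.play_nonneg c A _) (Finset.mem_univ e.1)
  have ha := hS.scale_pos e.1
  have ha1 := hS.scale_le_one e.1
  have hd : (0 : ℝ) ≤ d := by positivity
  rw [bonus]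
  set w := levelForm (S.play c A) (S.featVec A) S.reg e.1 (S.featVec A e.2) (S.featVec A e.2)
  set q := ∑ θ, S.play c A (e.1, θ)
  have hqw : 0 ≤ q * w := mul_nonneg hq0 hw0
  have hqw1 : q * w ≤ 1 / (2 * S.rate) := by nlinarith
  constructor <;> nlinarith

/-- Weighted loss and bonus are each at least `-1 / (2η)`; this is the condition under which the
exponential inequality applies. -/
theorem neg_rate_mul_estLoss_le (hS : S.Admissible) (c : S.Expert → ℝ) (A : Context d)
    (e' : S.Expert) (l : ℝ) (e : S.Expert) : -S.rate * S.estLoss c A e' l e ≤ 1 := by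
  have hη := hS.rate_pos
  have h1 : |impWeight (S.play c A) (S.featVec A) S.reg e e' * clip l| ≤ 1 / (2 * S.rate) := by
    rw [abs_mul]
    calc _ ≤ 1 / (2 * S.rate) * 1 :=
          mul_le_mul (abs_impWeight_le hS c A e e') (abs_clip_le l) (abs_nonneg _) (by positivity)
      _ = _ := mul_one _
  have h2 := (bonus_mem hS c A e).1
  have h3 : -(1 / S.rate) ≤ S.estLoss c A e' l e := by
    have : 1 / S.rate = 1 / (2 * S.rate) + 1 / (2 * S.rate) := by field_simp; norm_num
    rw [estLoss, this]
    linarith [(abs_le.1 h1).1]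
  have h4 := mul_le_mul_of_nonneg_left h3 hη.le
  have h5 : S.rate * -(1 / S.rate) = -1 := by field_simp
  linarith

theorem abs_estLoss_le (hS : S.Admissible) (c : S.Expert → ℝ) (A : Context d)
    (e' : S.Expert) (l : ℝ) (e : S.Expert) : |S.estLoss c A e' l e| ≤ 1 / S.rate + 8 * d := by
  have hη := hS.rate_pos
  have h1 : |impWeight (S.play c A) (S.featVec A) S.reg e e' * clip l| ≤ 1 / (2 * S.rate) := by
    rw [abs_mul]
    calc _ ≤ 1 / (2 * S.rate) * 1 :=
          mul_le_mul (abs_impWeight_le hS c A e e') (abs_clip_le l) (abs_nonneg _) (by positivity)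
      _ = _ := mul_one _
  obtain ⟨h2, h3⟩ := bonus_mem hS c A e
  have : 1 / S.rate = 1 / (2 * S.rate) + 1 / (2 * S.rate) := by field_simp; norm_num
  have hp : 0 < 1 / (2 * S.rate) := by positivity
  have hd : (0 : ℝ) ≤ d := by positivity
  rw [estLoss, this, abs_le]
  rw [abs_le] at h1
  constructor <;> linarith

variable (S) in
/-- The progress of the exponential weights with respect to the expert `es` in one round. -/
def progress (es : S.Expert) (c : S.Expert → ℝ) (A : Context d) (e' : S.Expert) (l : ℝ) : ℝ :=
  ∑ e, expWeights S.rate c e * S.estLoss c A e' l e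
    - S.rate * ∑ e, expWeights S.rate c e * S.estLoss c A e' l e ^ 2 - S.estLoss c A e' l es

/-- The increments of the potential telescope along the trajectory; no probability is involved. -/
theorem sum_progress_le_expPotential (hS : S.Admissible) (es : S.Expert) {T : ℕ}
    (h : Fin T → Obs d S.Expert) :
    ∑ t : Fin T, S.progress es (S.cumLoss t (past h t)) (h t).1 (h t).2.1.2 (h t).2.2 ≤
      expPotential S.rate (S.cumLoss T h) - S.cumLoss T h es := by
  induction T with
  | zero => simp [cumLoss, expPotential_zero]
  | succ T ih =>
    rw [Fin.sum_univ_castSucc]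
    have h1 := ih (fun i => h i.castSucc)
    have h2 := expPotential_add_ge hS.rate_pos (S.cumLoss T (fun i => h i.castSucc))
      (S.estLoss (S.cumLoss T (fun i => h i.castSucc)) (h (Fin.last T)).1 (h (Fin.last T)).2.1.2
        (h (Fin.last T)).2.2) (fun e => neg_rate_mul_estLoss_le hS _ _ _ _ e)
    have e1 : past h (Fin.last T) = fun i => h i.castSucc := rfl
    have e2 : S.progress es (S.cumLoss (Fin.last T) (past h (Fin.last T))) (h (Fin.last T)).1
        (h (Fin.last T)).2.1.2 (h (Fin.last T)).2.2 =
        S.progress es (S.cumLoss T (fun i => h i.castSucc)) (h (Fin.last T)).1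
        (h (Fin.last T)).2.1.2 (h (Fin.last T)).2.2 := rfl
    have e3 : ∑ t : Fin T, S.progress es (S.cumLoss (t.castSucc : Fin (T + 1))
        (past h t.castSucc)) (h t.castSucc).1 (h t.castSucc).2.1.2 (h t.castSucc).2.2 =
        ∑ t : Fin T, S.progress es (S.cumLoss t (past (fun i => h i.castSucc) t))
          (h t.castSucc).1 (h t.castSucc).2.1.2 (h t.castSucc).2.2 := rfl
    rw [e2, e3]
    simp only [cumLoss, progress] at *
    linarith

/-- The regret of exponential weights with respect to the estimated losses. -/
theorem sum_progress_le (hS : S.Admissible) (es : S.Expert) {T : ℕ}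
    (h : Fin T → Obs d S.Expert) :
    ∑ t : Fin T, S.progress es (S.cumLoss t (past h t)) (h t).1 (h t).2.1.2 (h t).2.2 ≤
      Real.log (Fintype.card S.Expert) / S.rate := by
  have h1 := sum_progress_le_expPotential hS es h
  have h2 := expPotential_le hS.rate_pos (S.cumLoss T h) es
  linarith

/-- A crude bound which serves only for integrability. -/
theorem abs_progress_le (hS : S.Admissible) (es : S.Expert) (c : S.Expert → ℝ) (A : Context d)
    (e' : S.Expert) (l : ℝ) : |S.progress es c A e' l| ≤
      2 * (1 / S.rate + 8 * d) + S.rate * (1 / S.rate + 8 * d) ^ 2 := by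
  have hη := hS.rate_pos
  set B := 1 / S.rate + 8 * (d : ℝ) with hB
  have hb := fun e => abs_estLoss_le hS c A e' l e
  have havg : ∀ g : S.Expert → ℝ, ∀ b, (∀ e, |g e| ≤ b) →
      |∑ e, expWeights S.rate c e * g e| ≤ b := by
    intro g b hg
    refine (Finset.abs_sum_le_sum_abs _ _).trans ?_
    have : b = ∑ e, expWeights S.rate c e * b := by rw [← Finset.sum_mul, sum_expWeights, one_mul]
    rw [this]
    refine Finset.sum_le_sum fun e _ => ?_
    rw [abs_mul, abs_of_nonneg (expWeights_nonneg _ _ _)]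
    exact mul_le_mul_of_nonneg_left (hg e) (expWeights_nonneg _ _ _)
  have h1 := havg _ B hb
  have h2 := havg (fun e => S.estLoss c A e' l e ^ 2) (B ^ 2) fun e => by
    rw [abs_pow]; exact pow_le_pow_left₀ (abs_nonneg _) (hb e) 2
  have h3 := hb es
  have h4 : |S.rate * ∑ e, expWeights S.rate c e * S.estLoss c A e' l e ^ 2| ≤
      S.rate * B ^ 2 := by
    rw [abs_mul, abs_of_pos hη]
    exact mul_le_mul_of_nonneg_left h2 hη.le
  rw [progress, abs_le]
  rw [abs_le] at h1 h3 h4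
  constructor <;> linarith

/-- From `(X l + b)² ≤ 2 X² + 2 b²` when `|l| ≤ 1`. Removing the loss from the quadratic term makes
the bound affine in it, so that its conditional mean needs only the mean of the loss. -/
theorem progressBound_le_progress (hS : S.Admissible) (es : S.Expert) (c : S.Expert → ℝ)
    (A : Context d) (e' : S.Expert) (l : ℝ) :
    progressBound S.rate S.scale (expWeights S.rate c) (S.play c A) (S.featVec A) S.reg es e'
      (clip l) ≤ S.progress es c A e' l := by
  have hη := hS.rate_pos
  have hsq : ∑ e, expWeights S.rate c e * S.estLoss c A e' l e ^ 2 ≤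
      2 * ∑ e, expWeights S.rate c e * impWeight (S.play c A) (S.featVec A) S.reg e e' ^ 2 +
      2 * ∑ e, expWeights S.rate c e * bonus S.scale (S.play c A) (S.featVec A) S.reg e ^ 2 := by
    rw [Finset.mul_sum, Finset.mul_sum, ← Finset.sum_add_distrib]
    refine Finset.sum_le_sum fun e _ => ?_
    rw [estLoss]
    set X := impWeight (S.play c A) (S.featVec A) S.reg e e'
    set b := bonus S.scale (S.play c A) (S.featVec A) S.reg e
    have h1 : (X * clip l + b) ^ 2 ≤ 2 * X ^ 2 + 2 * b ^ 2 := by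
      have h2 : clip l ^ 2 ≤ 1 := (sq_le_one_iff_abs_le_one _).2 (abs_clip_le l)
      have h3 : (X * clip l) ^ 2 ≤ X ^ 2 := by
        rw [mul_pow]; exact mul_le_of_le_one_right (sq_nonneg _) h2
      nlinarith [sq_nonneg (X * clip l - b)]
    have := mul_le_mul_of_nonneg_left h1 (expWeights_nonneg S.rate c e)
    linarith
  have := mul_le_mul_of_nonneg_left hsq hη.le
  simp only [progressBound, progress, estLoss] at *
  linarith

theorem measurable_progress (es : S.Expert) :
    Measurable (fun x : (((S.Expert → ℝ) × Context d) × ℝ) × S.Expert =>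
      S.progress es x.1.1.1 x.1.1.2 x.2 x.1.2) := by
  have h1 : ∀ e, Measurable (fun c : S.Expert → ℝ => expWeights S.rate c e) := fun e => by
    unfold expWeights
    fun_prop
  have h2 : ∀ e, Measurable (fun x : (((S.Expert → ℝ) × Context d) × ℝ) × S.Expert =>
      expWeights S.rate x.1.1.1 e) := fun e => (h1 e).comp (by fun_prop)
  unfold progress
  refine (Measurable.sub ?_ (Measurable.const_mul ?_ _)).sub (S.measurable_estLoss es)
  · exact Finset.measurable_fun_sum _ fun e _ => (h2 e).mul (S.measurable_estLoss e)
  · exact Finset.measurable_fun_sum _ fun e _ => (h2 e).mul ((S.measurable_estLoss e).pow_const 2)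

end Params

/-! ### Best linear approximation and the mean loss of a policy -/

section Misspec

variable {d : ℕ} {D : Measure (Context d)} {g : Action d → ℝ}

theorem bddAbove_range_misspec (hg : ∀ a ∈ Metric.closedBall (0 : Action d) 1, |g a| ≤ 1)
    (y : Metric.closedBall (0 : Action d) 1) :
    BddAbove (Set.range fun a : {a : Action d // ∃ A ∈ D.support, a ∈ A.actions} =>
      |g a - inner ℝ (a : Action d) y|) := by
  refine ⟨2, ?_⟩
  rintro _ ⟨⟨a, A, -, ha⟩, rfl⟩
  have h1 := hg a (A.2 ha)
  have h2 : |inner ℝ a (y : Action d)| ≤ 1 := by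
    refine (abs_real_inner_le_norm _ _).trans ?_
    have hy : ‖(y : Action d)‖ ≤ 1 := mem_closedBall_zero_iff.1 y.2
    nlinarith [Context.norm_le_one ha, norm_nonneg a, norm_nonneg (y : Action d)]
  have := abs_sub (g a) (inner ℝ a (y : Action d))
  dsimp only
  linarith

theorem misspec_nonneg : 0 ≤ misspec D g :=
  Real.iInf_nonneg fun _ => Real.iSup_nonneg fun _ => abs_nonneg _

/-- The infimum in the definition of the misspecification is attained. -/
theorem exists_misspec_minimizer (hg : ∀ a ∈ Metric.closedBall (0 : Action d) 1, |g a| ≤ 1) :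
    ∃ y : Action d, ‖y‖ ≤ 1 ∧ ∀ A ∈ D.support, ∀ a ∈ A.actions,
      |g a - inner ℝ a y| ≤ misspec D g := by
  have hne : Nonempty (Metric.closedBall (0 : Action d) 1) := ⟨⟨0, by simp⟩⟩
  have hex : ∀ n : ℕ, ∃ y : Metric.closedBall (0 : Action d) 1,
      ⨆ a : {a : Action d // ∃ A ∈ D.support, a ∈ A.actions}, |g a - inner ℝ (a : Action d) y|
        < misspec D g + 1 / (n + 1) := fun n =>
    exists_lt_of_ciInf_lt (lt_add_of_pos_right _ Nat.one_div_pos_of_nat)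
  choose y hy using hex
  -- Near-minimizers subconverge in the compact ball; for each fixed action the error bound passes
  -- to the limit.
  obtain ⟨z, hz, φ, hφ, hlim⟩ := (isCompact_closedBall (0 : Action d) 1).tendsto_subseq
    (fun n => (y n).2)
  refine ⟨z, by simpa using hz, fun A hA a ha => ?_⟩
  have h1 : ∀ n, |g a - inner ℝ a ((y (φ n) : Action d))| ≤ misspec D g + 1 / ((φ n : ℝ) + 1) :=
    fun n => (le_ciSup (bddAbove_range_misspec hg (y (φ n))) ⟨a, A, hA, ha⟩).trans (hy _).le
  have h2 : Filter.Tendsto (fun n => |g a - inner ℝ a ((y (φ n) : Action d))|) Filter.atTop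
      (nhds |g a - inner ℝ a z|) := by
    have hc : Continuous (fun v : Action d => |g a - inner ℝ a v|) := by fun_prop
    exact (hc.tendsto z).comp hlim
  have h3 : Filter.Tendsto (fun n => misspec D g + 1 / ((φ n : ℝ) + 1)) Filter.atTop
      (nhds (misspec D g + 0)) :=
    tendsto_const_nhds.add
      ((tendsto_one_div_add_atTop_nhds_zero_nat (𝕜 := ℝ)).comp hφ.tendsto_atTop)
  rw [add_zero] at h3
  exact le_of_tendsto_of_tendsto' h2 h3 h1

end Misspec

attribute [instance] Policy.markov

section PolicyLoss

variable {d : ℕ} {Mem : Type} [MeasurableSpace Mem] (env : Environment d Mem)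

theorem Environment.abs_f_le {t : ℕ} (h : Fin t → Round d Mem env.State) (s : env.State)
    {a : Action d} (ha : ‖a‖ ≤ 1) : |env.f t h s a| ≤ 1 :=
  abs_le.2 (env.f_mem t h s a (by simpa using ha))

theorem Environment.clip_f {t : ℕ} (h : Fin t → Round d Mem env.State) (s : env.State)
    {A : Context d} {a : Action d} (ha : a ∈ A.actions) :
    clip (env.f t h s a) = env.f t h s a :=
  clip_of_mem (env.f_mem t h s a (A.2 ha))

/-- The expected loss of a policy in a round, given the past and the hidden move. -/
def policyLoss (ρ : Policy d) (t : ℕ) (h : Fin t → Round d Mem env.State) (s : env.State) : ℝ :=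
  ∫ A, ∫ a, clip (env.f t h s a) ∂(ρ.kernel A) ∂env.D

theorem measurable_clip_f (t : ℕ) :
    Measurable (fun x : (Fin t → Round d Mem env.State) × env.State × Action d =>
      clip (env.f t x.1 x.2.1 x.2.2)) :=
  measurable_clip.comp (env.measurable_f t)

theorem measurable_integral_policy (ρ : Policy d) (t : ℕ) :
    Measurable (fun x : ((Fin t → Round d Mem env.State) × env.State) × Context d =>
      ∫ a, clip (env.f t x.1.1 x.1.2 a) ∂(ρ.kernel x.2)) := by
  have h : StronglyMeasurable (fun z : (((Fin t → Round d Mem env.State) × env.State) ×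
      Context d) × Action d => clip (env.f t z.1.1.1 z.1.1.2 z.2)) :=
    ((measurable_clip_f env t).comp
      (f := fun z : (((Fin t → Round d Mem env.State) × env.State) × Context d) × Action d =>
        (z.1.1.1, z.1.1.2, z.2)) (by fun_prop)).stronglyMeasurable
  exact (h.integral_kernel_prod_right' (κ := ρ.kernel.comap _ measurable_snd)).measurable

theorem measurable_policyLoss (ρ : Policy d) (t : ℕ) :
    Measurable (fun x : (Fin t → Round d Mem env.State) × env.State =>
      policyLoss env ρ t x.1 x.2) :=
  ((measurable_integral_policy env ρ t).stronglyMeasurable.integral_prod_right'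
    (ν := env.D)).measurable

theorem abs_policyLoss_le (ρ : Policy d) (t : ℕ) (h : Fin t → Round d Mem env.State)
    (s : env.State) : |policyLoss env ρ t h s| ≤ 1 :=
  abs_integral_le_of_bound fun _ => abs_integral_le_of_bound fun _ => abs_clip_le _

end PolicyLoss

/-! ### The learner's conditional regret in one round -/

namespace Params

variable {d : ℕ} (S : Params d)

theorem feat_mem (A : Context d) (θ : S.Net) : S.feat A θ ∈ A.actions := linPolicy_mem _ A

/-- The linear policy of a grid point. -/
def netPolicy (θ : S.Net) : Policy d where
  kernel := Kernel.deterministic (fun A => S.feat A θ) (S.measurable_feat θ)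
  mem A := by
    have hm : MeasurableSet {a | a ∉ A.actions} := A.1.isCompact.isClosed.measurableSet.compl
    rw [Kernel.deterministic_apply, ae_iff, Measure.dirac_apply' _ hm]
    simpa using S.feat_mem A θ

theorem integral_netPolicy (θ : S.Net) (A : Context d) {E : Type*} [NormedAddCommGroup E]
    [NormedSpace ℝ E] [CompleteSpace E] {g : Action d → E} (hg : StronglyMeasurable g) :
    ∫ a, g a ∂((S.netPolicy θ).kernel A) = g (S.feat A θ) := by
  rw [netPolicy, Kernel.deterministic_apply, integral_dirac' _ _ hg]

variable (env : Environment d S.Expert)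

/-- The regret of a round with respect to a policy. -/
def regretFn (π : Policy d) (t : ℕ)
    (z : (Fin t → Round d S.Expert env.State) × Round d S.Expert env.State) : ℝ :=
  clip (env.f t z.1 z.2.state z.2.action)
    - ∫ a, clip (env.f t z.1 z.2.state a) ∂(π.kernel z.2.context)

/-- The progress of the exponential weights as a function of past and present rounds. -/
def progressFn (es : S.Expert) (t : ℕ)
    (z : (Fin t → Round d S.Expert env.State) × Round d S.Expert env.State) : ℝ :=
  S.progress es (S.cumLoss t (fun i => (z.1 i).obs)) z.2.context z.2.1.2.2 z.2.2

theorem measurable_regretFn (π : Policy d) (t : ℕ) : Measurable (S.regretFn env π t) := by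
  unfold regretFn Round.state Round.action Round.context
  refine Measurable.sub ?_ ?_
  · exact (measurable_clip_f env t).comp
      (f := fun z : (Fin t → Round d S.Expert env.State) × Round d S.Expert env.State =>
        (z.1, z.2.1.1.1, z.2.1.2.1)) (by fun_prop)
  · exact (measurable_integral_policy env π t).comp
      (f := fun z : (Fin t → Round d S.Expert env.State) × Round d S.Expert env.State =>
        ((z.1, z.2.1.1.1), z.2.1.1.2)) (by fun_prop)

theorem abs_regretFn_le (π : Policy d) (t : ℕ)
    (z : (Fin t → Round d S.Expert env.State) × Round d S.Expert env.State) :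
    |S.regretFn env π t z| ≤ 2 := by
  have h1 := abs_clip_le (env.f t z.1 z.2.state z.2.action)
  have h2 : |∫ a, clip (env.f t z.1 z.2.state a) ∂(π.kernel z.2.context)| ≤ 1 :=
    abs_integral_le_of_bound fun _ => abs_clip_le _
  rw [regretFn]
  linarith [abs_sub (clip (env.f t z.1 z.2.state z.2.action))
    (∫ a, clip (env.f t z.1 z.2.state a) ∂(π.kernel z.2.context))]

theorem measurable_obs {Mem State : Type} [MeasurableSpace Mem] [MeasurableSpace State] :
    Measurable (Round.obs : Round d Mem State → Obs d Mem) := by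
  unfold Round.obs; fun_prop

theorem measurable_progressFn (es : S.Expert) (t : ℕ) :
    Measurable (S.progressFn env es t) := by
  have h1 : Measurable (fun z : (Fin t → Round d S.Expert env.State) ×
      Round d S.Expert env.State => S.cumLoss t (fun i => (z.1 i).obs)) :=
    (S.measurable_cumLoss t).comp (measurable_pi_lambda _ fun i =>
      measurable_obs.comp ((measurable_pi_apply i).comp measurable_fst))
  have h2 : Measurable (fun z : (Fin t → Round d S.Expert env.State) ×
      Round d S.Expert env.State => z.2.1.1.2) := by fun_prop
  have h3 : Measurable (fun z : (Fin t → Round d S.Expert env.State) ×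
      Round d S.Expert env.State => z.2.2) := by fun_prop
  have h4 : Measurable (fun z : (Fin t → Round d S.Expert env.State) ×
      Round d S.Expert env.State => z.2.1.2.2) := by fun_prop
  have h5 := (measurable_progress es).comp (((h1.prodMk h2).prodMk h3).prodMk h4)
  simp only [Function.comp_def] at h5
  unfold progressFn Round.context
  exact h5

/-- The mean loss of the learner in a round, given the past, the hidden move and the context. -/
def learnerLoss (t : ℕ) (h : Fin t → Round d S.Expert env.State) (s : env.State)
    (A : Context d) : ℝ :=
  ∑ e, S.play (S.cumLoss t (fun i => (h i).obs)) A e * env.f t h s (S.feat A e.2)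

theorem measurable_f_feat (t : ℕ) (h : Fin t → Round d S.Expert env.State) (s : env.State)
    (θ : S.Net) : Measurable (fun A => env.f t h s (S.feat A θ)) :=
  (env.measurable_f t).comp
    (measurable_const.prodMk (measurable_const.prodMk (S.measurable_feat θ)))

theorem norm_feat_le (A : Context d) (θ : S.Net) : ‖S.feat A θ‖ ≤ 1 :=
  Context.norm_le_one (linPolicy_mem (S.gridPoint θ) A)

theorem integrable_learnerLoss (t : ℕ) (h : Fin t → Round d S.Expert env.State)
    (s : env.State) : Integrable (S.learnerLoss env t h s) env.D := by
  refine integrable_of_bound (C := 1) ?_ fun A => ?_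
  · refine Finset.measurable_fun_sum _ fun e _ => ?_
    exact ((S.measurable_play e).comp (measurable_const.prodMk measurable_id)).mul
      (S.measurable_f_feat env t h s e.2)
  · refine (Finset.abs_sum_le_sum_abs _ _).trans ?_
    rw [← S.sum_play (S.cumLoss t (fun i => (h i).obs)) A]
    refine Finset.sum_le_sum fun e _ => ?_
    rw [abs_mul, abs_of_nonneg (S.play_nonneg _ _ _)]
    exact mul_le_of_le_one_right (S.play_nonneg _ _ _) (env.abs_f_le h s (S.norm_feat_le A e.2))

theorem roundMean_regretFn (π : Policy d) (t : ℕ) (h : Fin t → Round d S.Expert env.State)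
    (s : env.State) : roundMean S.learner env t (S.regretFn env π t) h s =
      ∫ A, S.learnerLoss env t h s A ∂env.D - policyLoss env π t h s := by
  have hint : Integrable (fun A => ∫ a, clip (env.f t h s a) ∂(π.kernel A)) env.D :=
    integrable_of_bound ((measurable_integral_policy env π t).comp
      (f := fun A => ((h, s), A)) (by fun_prop))
      fun _ => abs_integral_le_of_bound fun _ => abs_clip_le _
  rw [policyLoss, ← integral_sub (S.integrable_learnerLoss env t h s) hint]
  rw [roundMean]
  refine integral_congr_ae (Filter.Eventually.of_forall fun A => ?_)
  simp only [regretFn, Round.state, Round.action, Round.context, integral_const, probReal_univ,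
    one_smul]
  rw [S.integral_actKernel t _ (g := fun p => clip (env.f t h s p.1) -
    ∫ a, clip (env.f t h s a) ∂(π.kernel A))]
  · simp only [mul_sub, Finset.sum_sub_distrib, ← Finset.sum_mul, S.sum_play, one_mul, learnerLoss]
    congr 1
    refine Finset.sum_congr rfl fun e _ => ?_
    rw [env.clip_f h s (S.feat_mem A e.2)]
  · exact ((measurable_clip_f env t).comp
      (f := fun p : Action d × S.Expert => (h, s, p.1)) (by fun_prop)).sub measurable_const

theorem policyLoss_netPolicy (θ : S.Net) (t : ℕ) (h : Fin t → Round d S.Expert env.State)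
    (s : env.State) :
    policyLoss env (S.netPolicy θ) t h s = ∫ A, env.f t h s (S.feat A θ) ∂env.D := by
  refine integral_congr_ae (Filter.Eventually.of_forall fun A => ?_)
  dsimp only
  rw [S.integral_netPolicy θ A (g := fun a => clip (env.f t h s a))]
  · exact env.clip_f h s (S.feat_mem A θ)
  · exact ((measurable_clip_f env t).comp
      (f := fun a : Action d => (h, s, a)) (by fun_prop)).stronglyMeasurable

theorem progressBound_eq_affine {M : ℕ} {Θ : Type*} [Fintype Θ] (η : ℝ) (α : Fin M → ℝ)
    (P R : Fin M × Θ → ℝ) (x : Θ → Fin d → ℝ) (lam : ℝ) (es e' : Fin M × Θ) (l : ℝ) :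
    progressBound η α P R x lam es e' l =
      (∑ e, P e * impWeight R x lam e e' - impWeight R x lam es e') * l
        + progressBound η α P R x lam es e' 0 := by
  simp only [progressBound, mul_add, Finset.sum_add_distrib, mul_zero, zero_add, sub_mul,
    Finset.sum_mul, mul_assoc]
  ring

variable {S}

theorem progressBound_le_integral (hS : S.Admissible) (es : S.Expert) (t : ℕ)
    (h : Fin t → Round d S.Expert env.State) (s : env.State) (A : Context d)
    (c : S.Expert → ℝ) (e' : S.Expert) :
    progressBound S.rate S.scale (expWeights S.rate c) (S.play c A) (S.featVec A) S.reg es e'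
      (env.f t h s (S.feat A e'.2)) ≤
      ∫ l, S.progress es c A e' l ∂(env.loss t (h, s, A, S.feat A e'.2)) := by
  have hmem : S.feat A e'.2 ∈ A.actions := linPolicy_mem _ A
  have hint : Integrable clip (env.loss t (h, s, A, S.feat A e'.2)) :=
    integrable_of_bound measurable_clip abs_clip_le
  have hmean : ∫ l, clip l ∂(env.loss t (h, s, A, S.feat A e'.2)) =
      env.f t h s (S.feat A e'.2) := by
    rw [← env.loss_mean t h s A _ hmem]
    refine integral_congr_ae ?_
    filter_upwards [env.loss_mem t h s A _ hmem] with l hl using clip_of_mem hl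
  have hm : Measurable (fun l => S.progress es c A e' l) :=
    (measurable_progress es).comp (f := fun l => (((c, A), l), e')) (by fun_prop)
  have hle := fun l => progressBound_le_progress hS es c A e' l
  have haff := progressBound_eq_affine S.rate S.scale (expWeights S.rate c) (S.play c A)
    (S.featVec A) S.reg es e'
  simp only [haff (clip _)] at hle
  rw [haff, ← hmean]
  refine le_of_eq_of_le ?_ (integral_mono ((hint.const_mul _).add (integrable_const _))
    (integrable_of_bound hm fun _ => abs_progress_le hS _ _ _ _ _) hle)
  simp only [Pi.add_apply]
  rw [integral_add (hint.const_mul _) (integrable_const _), integral_const_mul,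
    integral_const, probReal_univ, one_smul]

/-- The one-round regret with respect to a linear policy, in terms of the misspecification. -/
theorem learnerLoss_sub_le (hS : S.Admissible) (es : S.Expert) (t : ℕ)
    (h : Fin t → Round d S.Expert env.State) (s : env.State) :
    ∫ A, S.learnerLoss env t h s A ∂env.D - policyLoss env (S.netPolicy es.2) t h s ≤
      roundMean S.learner env t (S.progressFn env es t) h s
      + (6 * d * S.explore + 4 * S.rate * d * S.levels + 2 * √(S.reg / (2 * S.rate))
        + (4 * √d) * misspec env.D (env.f t h s)
        + misspec env.D (env.f t h s) ^ 2 / (4 * S.scale es.1) + 8 * d * S.scale es.1) := by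
  set K := 6 * d * S.explore + 4 * S.rate * d * S.levels + 2 * √(S.reg / (2 * S.rate))
        + (4 * √d) * misspec env.D (env.f t h s)
        + misspec env.D (env.f t h s) ^ 2 / (4 * S.scale es.1) + 8 * d * S.scale es.1 with hK
  obtain ⟨y, hy, hyf⟩ := exists_misspec_minimizer (D := env.D) (g := env.f t h s)
    fun a ha => env.abs_f_le h s (by simpa using ha)
  set c := S.cumLoss t (fun i => (h i).obs) with hc
  have hfint : Integrable (fun A => env.f t h s (S.feat A es.2)) env.D :=
    integrable_of_bound (S.measurable_f_feat env t h s es.2)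
      fun A => env.abs_f_le h s (S.norm_feat_le A es.2)
  rw [policyLoss_netPolicy, ← integral_sub (S.integrable_learnerLoss env t h s) hfint, roundMean,
    ← sub_le_iff_le_add]
  have hKi : ∫ _A, K ∂env.D = K := by simp
  have hI : Integrable (fun A => S.learnerLoss env t h s A - env.f t h s (S.feat A es.2)) env.D :=
    (S.integrable_learnerLoss env t h s).sub hfint
  rw [← hKi, ← integral_sub hI (integrable_const _)]
  have hm2 : Measurable (fun A : Context d =>
      ∫ p, ∫ l, S.progressFn env es t (h, (((s, A), p), l)) ∂(env.loss t (h, s, A, p.1))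
        ∂(S.learner.act t (fun i => (h i).obs, A))) :=
    (measurable_integral_act (L := S.learner) (S.measurable_progressFn env es t)).comp
      (f := fun A : Context d => (h, (s, A))) (by fun_prop)
  refine integral_mono_ae (hI.sub (integrable_const _)) (integrable_of_bound hm2 fun A =>
    abs_integral_le_of_bound fun _ =>
      abs_integral_le_of_bound fun _ => abs_progress_le hS _ _ _ _ _) ?_
  -- The bound is proved for each action set in the support of `D`, all with the same approximating
  -- vector `y`, and then integrated over `D`.
  filter_upwards [Measure.support_mem_ae (μ := env.D)] with A hA
  have hm1 : Measurable (fun p : Action d × S.Expert =>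
      ∫ l, S.progressFn env es t (h, (((s, A), p), l)) ∂(env.loss t (h, s, A, p.1))) :=
    (measurable_integral_loss (L := S.learner) (S.measurable_progressFn env es t)).comp
      (f := fun p : Action d × S.Expert => (h, ((s, A), p))) (by fun_prop)
  have hact : ∫ p, ∫ l, S.progressFn env es t (h, (((s, A), p), l)) ∂(env.loss t (h, s, A, p.1))
        ∂(S.learner.act t (fun i => (h i).obs, A)) =
      ∑ e', S.play c A e' * ∫ l, S.progress es c A e' l ∂(env.loss t (h, s, A, S.feat A e'.2)) :=
    S.integral_actKernel t _ hm1
  rw [hact, sub_le_iff_le_add]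
  have hdot : ∀ u v : Action d, u.ofLp ⬝ᵥ v.ofLp = inner ℝ u v := fun u v => by
    rw [EuclideanSpace.inner_eq_star_dotProduct, star_trivial, dotProduct_comm]
  have hone := regret_le_progressBound (P := expWeights S.rate c) (R := S.play c A)
    (N := S.exploreDist A) (x := S.featVec A) (lam := S.reg) (γ := S.explore) (η := S.rate)
    (α := S.scale) (F := fun θ => env.f t h s (S.feat A θ)) (y := y.ofLp)
    (ε := misspec env.D (env.f t h s)) S.one_le_dim S.reg_pos (expWeights_nonneg _ _)
    (sum_expWeights _ _) (S.exploreDist_nonneg A) (S.sum_exploreDist A) S.levels_pos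
    S.explore_nonneg S.explore_le (fun _ => rfl) hS.scale_pos hS.scale_le_one hS.rate_pos
    hS.rate_mul_dim_le (levelForm_le hS c A)
    (by rw [hdot, real_inner_self_eq_norm_sq]; nlinarith [norm_nonneg y])
    (fun θ => by
      rw [show S.featVec A θ = (S.feat A θ).ofLp from rfl, hdot]
      exact hyf A hA _ (linPolicy_mem _ A))
    misspec_nonneg (fun θ => env.abs_f_le h s (S.norm_feat_le A θ)) es
  refine hone.trans ?_
  gcongr with e' _
  · exact S.play_nonneg c A e'
  · exact progressBound_le_integral env hS es t h s A c e'

end Params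

/-! ### From arbitrary policies to linear policies of the grid -/

/-- The mean of a family of approximately linear quantities is approximately linear. -/
theorem exists_mean_approx_linear {Ω ι : Type*} [MeasurableSpace Ω] {μ : Measure Ω}
    [IsProbabilityMeasure μ] [Fintype ι] {d : ℕ} {V : Ω → ι → ℝ}
    (hV : ∀ i, Integrable (fun ω => V ω i) μ) (x : ι → Action d) (r b : ℝ)
    (h : ∀ᵐ ω ∂μ, ∃ Y : Action d, ‖Y‖ ≤ r ∧ ∀ i, |V ω i - inner ℝ (x i) Y| ≤ b) :
    ∃ Y : Action d, ‖Y‖ ≤ r ∧ ∀ i, |∫ ω, V ω i ∂μ - inner ℝ (x i) Y| ≤ b := by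
  -- The set of approximately linear value vectors is convex and closed, so it contains the mean of
  -- `V`. No measurable choice of the approximating vectors is needed.
  let K : Set (ι → ℝ) := {v | ∃ Y : Action d, ‖Y‖ ≤ r ∧ ∀ i, |v i - inner ℝ (x i) Y| ≤ b}
  have hconv : Convex ℝ K := by
    rintro v ⟨Y, hY, hv⟩ w ⟨Z, hZ, hw⟩ p q hp hq hpq
    refine ⟨p • Y + q • Z, ?_, fun i => ?_⟩
    · calc ‖p • Y + q • Z‖ ≤ p * ‖Y‖ + q * ‖Z‖ := by
            refine (norm_add_le _ _).trans ?_
            rw [norm_smul, norm_smul, Real.norm_of_nonneg hp, Real.norm_of_nonneg hq]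
        _ ≤ p * r + q * r := by gcongr
        _ = r := by rw [← add_mul, hpq, one_mul]
    · have e : (p • v + q • w) i - inner ℝ (x i) (p • Y + q • Z) =
          p * (v i - inner ℝ (x i) Y) + q * (w i - inner ℝ (x i) Z) := by
        simp only [Pi.add_apply, Pi.smul_apply, smul_eq_mul, inner_add_right, inner_smul_right]
        ring
      rw [e]
      refine (abs_add_le _ _).trans ?_
      rw [abs_mul, abs_mul, abs_of_nonneg hp, abs_of_nonneg hq]
      calc _ ≤ p * b + q * b := by gcongr <;> [exact hv i; exact hw i]
        _ = b := by rw [← add_mul, hpq, one_mul]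
  have hK : K = (fun z : Action d × (ι → ℝ) => fun i => inner ℝ (x i) z.1 + z.2 i) ''
      (Metric.closedBall 0 r ×ˢ Set.pi Set.univ fun _ => Set.Icc (-b) b) := by
    ext v
    constructor
    · rintro ⟨Y, hY, hv⟩
      refine ⟨(Y, fun i => v i - inner ℝ (x i) Y), ⟨by simpa using hY, fun i _ => ?_⟩, ?_⟩
      · exact abs_le.1 (hv i)
      · funext i; simp
    · rintro ⟨⟨Y, e⟩, ⟨hY, he⟩, rfl⟩
      refine ⟨Y, by simpa using hY, fun i => ?_⟩
      simpa using abs_le.2 (he i (Set.mem_univ i))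
  have hclosed : IsClosed K := by
    rw [hK]
    refine (IsCompact.image ((isCompact_closedBall 0 r).prod
      (isCompact_univ_pi fun _ => isCompact_Icc)) ?_).isClosed
    fun_prop
  have hmem := hconv.integral_mem hclosed (f := V) (μ := μ) h (Integrable.of_eval hV)
  obtain ⟨Y, hY, hv⟩ := hmem
  refine ⟨Y, hY, fun i => ?_⟩
  rw [← eval_integral hV]
  exact hv i

section PolicyMean

variable {d : ℕ} (D : Measure (Context d)) [IsProbabilityMeasure D] (ρ : Policy d)

/-- The mean action of a policy. -/
def policyMean : Action d := ∫ A, ∫ a, a ∂(ρ.kernel A) ∂D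

theorem Policy.ae_norm_le (A : Context d) : ∀ᵐ a ∂(ρ.kernel A), ‖a‖ ≤ 1 := by
  filter_upwards [ρ.mem A] with a ha using Context.norm_le_one ha

theorem Policy.integrable_id (A : Context d) : Integrable (fun a => a) (ρ.kernel A) :=
  Integrable.of_bound aestronglyMeasurable_id 1 (ρ.ae_norm_le A)

theorem Policy.integrable_mean : Integrable (fun A => ∫ a, a ∂(ρ.kernel A)) D := by
  have h : StronglyMeasurable (fun z : Context d × Action d => z.2) :=
    measurable_snd.stronglyMeasurable
  refine Integrable.of_bound (h.integral_kernel_prod_right' (κ := ρ.kernel)).aestronglyMeasurable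
    1 (Filter.Eventually.of_forall fun A => ?_)
  simpa using norm_integral_le_of_norm_le_const (ρ.ae_norm_le A)

theorem inner_policyMean (y : Action d) :
    inner ℝ (policyMean D ρ) y = ∫ A, ∫ a, inner ℝ a y ∂(ρ.kernel A) ∂D := by
  rw [real_inner_comm, policyMean, ← integral_inner (ρ.integrable_mean D)]
  refine integral_congr_ae (Filter.Eventually.of_forall fun A => ?_)
  dsimp only
  rw [← integral_inner (ρ.integrable_id A)]
  simp only [real_inner_comm]

theorem integrable_integral_inner (y : Action d) :
    Integrable (fun A => ∫ a, inner ℝ a y ∂(ρ.kernel A)) D := by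
  refine ((ρ.integrable_mean D).const_inner y).congr (Filter.Eventually.of_forall fun A => ?_)
  dsimp only
  rw [← integral_inner (ρ.integrable_id A)]
  simp only [real_inner_comm]

theorem abs_policyLoss_sub_le {Mem : Type} [MeasurableSpace Mem] (env : Environment d Mem)
    (t : ℕ) (h : Fin t → Round d Mem env.State) (s : env.State) {y : Action d} {b : ℝ}
    (hb : ∀ A ∈ env.D.support, ∀ a ∈ A.actions, |env.f t h s a - inner ℝ a y| ≤ b) :
    |policyLoss env ρ t h s - inner ℝ (policyMean env.D ρ) y| ≤ b := by
  have hi1 : Integrable (fun A => ∫ a, clip (env.f t h s a) ∂(ρ.kernel A)) env.D :=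
    integrable_of_bound ((measurable_integral_policy env ρ t).comp
      (f := fun A => ((h, s), A)) (by fun_prop))
      fun _ => abs_integral_le_of_bound fun _ => abs_clip_le _
  rw [inner_policyMean, policyLoss, ← integral_sub hi1 (integrable_integral_inner env.D ρ y)]
  have := norm_integral_le_of_norm_le_const (μ := env.D) (C := b)
    (f := fun A => ∫ a, clip (env.f t h s a) ∂(ρ.kernel A) - ∫ a, inner ℝ a y ∂(ρ.kernel A)) ?_
  · simpa using this
  · filter_upwards [Measure.support_mem_ae (μ := env.D)] with A hA
    have hi2 : Integrable (fun a => clip (env.f t h s a)) (ρ.kernel A) :=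
      integrable_of_bound ((measurable_clip_f env t).comp
        (f := fun a : Action d => (h, s, a)) (by fun_prop)) fun _ => abs_clip_le _
    have hi3 : Integrable (fun a => inner ℝ a y) (ρ.kernel A) :=
      (ρ.integrable_id A).inner_const y
    rw [← integral_sub hi2 hi3]
    have := norm_integral_le_of_norm_le_const (μ := ρ.kernel A) (C := b)
      (f := fun a => clip (env.f t h s a) - inner ℝ a y) ?_
    · simpa using this
    · filter_upwards [ρ.mem A] with a ha
      rw [env.clip_f h s ha]
      exact hb A hA a ha

end PolicyMean

namespace Params

variable {d : ℕ} (S : Params d)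

/-- After scaling by the mesh the grid is integral, and rounding down moves each coordinate by at
most one. -/
theorem exists_gridPoint_near (hT : 0 < S.mesh) {Y : Action d} (hY : ‖Y‖ ≤ S.mesh) :
    ∃ θ : S.Net, ‖Y - (S.mesh : ℝ) • S.gridPoint θ‖ ≤ √d := by
  have hT' : (0 : ℝ) < S.mesh := by exact_mod_cast hT
  have hYi : ∀ i, |Y i| ≤ S.mesh := fun i => (PiLp.norm_apply_le Y i).trans hY
  have hlt : ∀ i, ⌊Y i + S.mesh⌋₊ < 2 * S.mesh + 1 := fun i => by
    rw [Nat.floor_lt' (by omega)]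
    push_cast
    linarith [(abs_le.1 (hYi i)).2]
  refine ⟨fun i => ⟨⌊Y i + S.mesh⌋₊, hlt i⟩, ?_⟩
  rw [EuclideanSpace.norm_eq]
  refine Real.sqrt_le_sqrt ?_
  calc _ ≤ ∑ _i : Fin d, (1 : ℝ) := by
        refine Finset.sum_le_sum fun i _ => ?_
        have h1 := Nat.floor_le (by linarith [(abs_le.1 (hYi i)).1] : 0 ≤ Y i + S.mesh)
        have h2 := Nat.lt_floor_add_one (Y i + S.mesh)
        have e : (Y - (S.mesh : ℝ) • S.gridPoint fun i => ⟨⌊Y i + S.mesh⌋₊, hlt i⟩) i =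
            Y i + S.mesh - ⌊Y i + S.mesh⌋₊ := by
          simp only [gridPoint, PiLp.sub_apply, PiLp.smul_apply, smul_eq_mul]
          field_simp
          ring
        rw [e, Real.norm_eq_abs, sq_abs]
        nlinarith
    _ = d := by simp

/-- The grid policy is optimal for `⟨·, θ⟩` on every action set; replacing that functional by `⟨·,
Y⟩` costs at most `b` on either side. -/
theorem inner_policyMean_netPolicy_le (D : Measure (Context d)) [IsProbabilityMeasure D]
    (π : Policy d) {Y : Action d} {θ : S.Net} {b : ℝ}
    (hθ : ‖Y - (S.mesh : ℝ) • S.gridPoint θ‖ ≤ b) :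
    inner ℝ (policyMean D (S.netPolicy θ)) Y ≤ inner ℝ (policyMean D π) Y + 2 * b := by
  have hpt : ∀ A : Context d, ∀ a ∈ A.actions, inner ℝ (S.feat A θ) Y ≤ inner ℝ a Y + 2 * b := by
    intro A a ha
    set Z := Y - (S.mesh : ℝ) • S.gridPoint θ with hZ
    have hYZ : Y = Z + (S.mesh : ℝ) • S.gridPoint θ := by rw [hZ]; abel
    have h1 : inner ℝ (S.feat A θ) (S.gridPoint θ) ≤ inner ℝ a (S.gridPoint θ) :=
      inner_linPolicy_le _ A ha
    have h2 : |inner ℝ (S.feat A θ) Z| ≤ b :=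
      (abs_real_inner_le_norm _ _).trans (by
        nlinarith [S.norm_feat_le A θ, norm_nonneg (S.feat A θ), norm_nonneg Z])
    have h3 : |inner ℝ a Z| ≤ b :=
      (abs_real_inner_le_norm _ _).trans (by
        nlinarith [Context.norm_le_one ha, norm_nonneg a, norm_nonneg Z])
    have h4 := mul_le_mul_of_nonneg_left h1 (Nat.cast_nonneg (α := ℝ) S.mesh)
    rw [hYZ, inner_add_right, inner_add_right, inner_smul_right, inner_smul_right]
    linarith [(abs_le.1 h2).2, (abs_le.1 h3).1]
  have hb : 2 * b = ∫ _A, 2 * b ∂D := by simp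
  rw [inner_policyMean, inner_policyMean, hb,
    ← integral_add (integrable_integral_inner D π Y) (integrable_const _)]
  refine integral_mono (integrable_integral_inner D _ Y)
    ((integrable_integral_inner D π Y).add (integrable_const _)) fun A => ?_
  have hsm : StronglyMeasurable (fun a : Action d => inner ℝ a Y) :=
    (by fun_prop : Continuous fun a : Action d => inner ℝ a Y).stronglyMeasurable
  have hi : Integrable (fun a => inner ℝ a Y) (π.kernel A) := (π.integrable_id A).inner_const Y
  dsimp only [Pi.add_apply]
  rw [S.integral_netPolicy θ A hsm]
  have hc1 : inner ℝ (S.feat A θ) Y = ∫ _a, inner ℝ (S.feat A θ) Y ∂(π.kernel A) := by simp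
  have hc2 : 2 * b = ∫ _a, 2 * b ∂(π.kernel A) := by simp
  rw [hc1, hc2, ← integral_add hi (integrable_const _)]
  refine integral_mono_ae (integrable_const _) (hi.add (integrable_const _)) ?_
  filter_upwards [π.mem A] with a ha using hpt A a ha

variable (env : Environment d S.Expert)

theorem measurableSet_action_eq_feat :
    MeasurableSet {r : Round d S.Expert env.State | r.1.2.1 = S.feat r.1.1.2 r.1.2.2.2} := by
  refine measurableSet_eq_fun (by fun_prop) ?_
  have h : Measurable (fun x : Context d × S.Expert => S.feat x.1 x.2.2) :=
    measurable_from_prod_countable_left fun e => S.measurable_feat e.2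
  exact h.comp (f := fun r : Round d S.Expert env.State => (r.1.1.2, r.1.2.2)) (by fun_prop)

/-- The stronger event that the action is the one prescribed by the recorded expert is used, since
it is an equality of measurable functions. -/
theorem ae_action_mem (T : ℕ) : ∀ᵐ h ∂(law S.learner env T), ∀ t : Fin T,
    (h t).action ∈ (h t).context.actions := by
  rw [ae_all_iff]
  intro t
  let B : Set (Round d S.Expert env.State) := {r | r.1.2.1 = S.feat r.1.1.2 r.1.2.2.2}ᶜ
  have hB : MeasurableSet B := (S.measurableSet_action_eq_feat env).compl
  have hm : Measurable (fun z : (Fin t → Round d S.Expert env.State) ×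
      Round d S.Expert env.State => B.indicator (fun _ => (1 : ℝ)) z.2) :=
    (measurable_const.indicator hB).comp measurable_snd
  have hC : ∀ z : (Fin t → Round d S.Expert env.State) × Round d S.Expert env.State,
      |B.indicator (fun _ => (1 : ℝ)) z.2| ≤ 1 := fun z => by
    by_cases hz : z.2 ∈ B <;> simp [hz]
  have htower := integral_law_eq (L := S.learner) (env := env) t hm hC
  have hzero : ∀ (h : Fin t → Round d S.Expert env.State) (s : env.State),
      roundMean S.learner env t (fun z => B.indicator (fun _ => (1 : ℝ)) z.2) h s = 0 := by
    intro h s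
    rw [roundMean]
    refine integral_eq_zero_of_ae (Filter.Eventually.of_forall fun A => ?_)
    refine integral_eq_zero_of_ae ?_
    have hms : MeasurableSet {p : Action d × S.Expert | p.1 = S.feat A p.2.2} := by
      refine measurableSet_eq_fun measurable_fst ?_
      exact (Measurable.of_discrete (f := fun e : S.Expert => S.feat A e.2)).comp measurable_snd
    filter_upwards [S.ae_actKernel t (fun i => (h i).obs, A)
      (p := fun p => p.1 = S.feat A p.2.2) (fun e => rfl) hms] with p hp
    refine integral_eq_zero_of_ae (Filter.Eventually.of_forall fun l => ?_)
    refine Set.indicator_of_notMem ?_ _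
    simp only [B, Set.mem_compl_iff, not_not]
    exact hp
  simp only [hzero, integral_zero] at htower
  have hm' : Measurable (fun h : Fin T → Round d S.Expert env.State =>
      B.indicator (fun _ => (1 : ℝ)) (h t)) :=
    (measurable_const.indicator hB).comp (measurable_pi_apply t)
  rw [integral_eq_zero_iff_of_nonneg (fun h => Set.indicator_nonneg (fun _ _ => zero_le_one) _)
    (integrable_of_bound hm' fun h => hC (past h t, h t))] at htower
  filter_upwards [htower] with h hh
  have hn : h t ∉ B := fun hb => by
    have h1 : B.indicator (fun _ => (1 : ℝ)) (h t) = 0 := hh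
    rw [Set.indicator_of_mem hb] at h1
    exact one_ne_zero h1
  have he : (h t).action = S.feat (h t).context (h t).1.2.2.2 := not_not.1 hn
  rw [he]
  exact S.feat_mem _ _

theorem regret_eq (T : ℕ) (π : Policy d) :
    regret S.learner env T π = ∫ h, ∑ t : Fin T,
      roundMean S.learner env t (S.regretFn env π t) (past h t) (h t).state
        ∂(law S.learner env T) := by
  rw [← integral_law_sum_eq (L := S.learner) (fun t : Fin T => S.regretFn env π t)
    (fun t => S.measurable_regretFn env π t) (fun t z => S.abs_regretFn_le env π t z), regret]
  refine integral_congr_ae ?_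
  filter_upwards [S.ae_action_mem env T] with h hh
  refine Finset.sum_congr rfl fun t _ => ?_
  rw [regretFn, env.clip_f (past h t) (h t).state (hh t)]
  congr 1
  refine integral_congr_ae ?_
  filter_upwards [π.mem (h t).context] with a ha
  exact (env.clip_f (past h t) (h t).state ha).symm

end Params

/-! ### The regret bound over all rounds -/

section MisspecBound

variable {d : ℕ} {L : Learner d} {env : Environment d L.Mem} {T : ℕ} {ε : ℝ}

theorem MisspecBound.nonneg (h : MisspecBound L env T ε) : 0 ≤ ε := by
  obtain ⟨_, hω⟩ := Filter.Eventually.exists h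
  exact (Real.sqrt_nonneg _).trans hω

theorem MisspecBound.ae_sum_sq_le (hT : 0 < T) (h : MisspecBound L env T ε) :
    ∀ᵐ ω ∂(law L env T), ∑ t : Fin T, misspec env.D (lossFn L env ω t) ^ 2 ≤ T * ε ^ 2 := by
  have hT' : (0 : ℝ) < T := by exact_mod_cast hT
  filter_upwards [h] with ω hω
  rw [Real.sqrt_le_left h.nonneg] at hω
  calc _ = T * ((1 / (T : ℝ)) * ∑ t : Fin T, misspec env.D (lossFn L env ω t) ^ 2) := by
        field_simp
    _ ≤ _ := by gcongr

theorem MisspecBound.ae_sum_le (hT : 0 < T) (h : MisspecBound L env T ε) :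
    ∀ᵐ ω ∂(law L env T), ∑ t : Fin T, misspec env.D (lossFn L env ω t) ≤ T * ε := by
  filter_upwards [h.ae_sum_sq_le hT] with ω hω
  have h1 := sq_sum_le_card_mul_sum_sq (s := Finset.univ)
    (f := fun t : Fin T => misspec env.D (lossFn L env ω t))
  simp only [Finset.card_univ, Fintype.card_fin] at h1
  have h2 := mul_le_mul_of_nonneg_left hω (Nat.cast_nonneg (α := ℝ) T)
  refine le_of_sq_le_sq ?_ (mul_nonneg (Nat.cast_nonneg _) h.nonneg)
  nlinarith

end MisspecBound

theorem integral_le_of_ae_le_const {α : Type*} [MeasurableSpace α] {μ : Measure α}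
    [IsProbabilityMeasure μ] {f : α → ℝ} {c : ℝ} (hf : Integrable f μ) (h : ∀ᵐ x ∂μ, f x ≤ c) :
    ∫ x, f x ∂μ ≤ c := by
  have := integral_mono_ae hf (integrable_const c) h
  simpa using this

namespace Params

variable {d : ℕ} {S : Params d}

theorem regret_le_two_mul (env : Environment d S.Expert) (T : ℕ) (π : Policy d) :
    regret S.learner env T π ≤ 2 * T := by
  rw [regret_eq]
  refine (le_abs_self _).trans (abs_integral_le_of_bound fun h => ?_)
  refine (Finset.abs_sum_le_sum_abs _ _).trans ?_
  calc _ ≤ ∑ _t : Fin T, (2 : ℝ) := Finset.sum_le_sum fun t _ =>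
        abs_roundMean_le (L := S.learner) (φ := S.regretFn env π t)
          (fun z => S.abs_regretFn_le env π t z) _ _
    _ = 2 * T := by simp [mul_comm]

theorem measurable_sum_past {env : Environment d S.Expert} {T : ℕ}
    {g : (t : Fin T) → (Fin t → Round d S.Expert env.State) → env.State → ℝ}
    (hg : ∀ t : Fin T, Measurable (fun x : (Fin t → Round d S.Expert env.State) × env.State =>
      g t x.1 x.2)) :
    Measurable (fun h : Fin T → Round d S.Expert env.State =>
      ∑ t : Fin T, g t (past h t) (h t).state) := by
  have hst : Measurable (fun r : Round d S.Expert env.State => r.state) := by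
    unfold Round.state; fun_prop
  exact Finset.measurable_fun_sum _ fun t _ => (hg t).comp
    ((measurable_past t).prodMk (hst.comp (measurable_pi_apply t)))

theorem integrable_sum_past {env : Environment d S.Expert} {T : ℕ}
    {g : (t : Fin T) → (Fin t → Round d S.Expert env.State) → env.State → ℝ} {C : ℝ}
    (hg : ∀ t : Fin T, Measurable (fun x : (Fin t → Round d S.Expert env.State) × env.State =>
      g t x.1 x.2)) (hC : ∀ t h s, |g t h s| ≤ C) :
    Integrable (fun h : Fin T → Round d S.Expert env.State =>
      ∑ t : Fin T, g t (past h t) (h t).state) (law S.learner env T) :=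
  integrable_of_bound (C := ∑ _t : Fin T, C) (measurable_sum_past hg) fun _ =>
    (Finset.abs_sum_le_sum_abs _ _).trans (Finset.sum_le_sum fun t _ => hC t _ _)

/-- In the mean, the best linear policy on the grid is nearly as good as any policy. -/
theorem exists_netPolicy_le (env : Environment d S.Expert) {T : ℕ} (hT : 0 < T)
    (hmesh : S.mesh = T) {ε : ℝ} (hε : MisspecBound S.learner env T ε) (π : Policy d) :
    ∃ θ : S.Net, ∫ h, ∑ t : Fin T, policyLoss env (S.netPolicy θ) t (past h t) (h t).state
        ∂(law S.learner env T) ≤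
      ∫ h, ∑ t : Fin T, policyLoss env π t (past h t) (h t).state ∂(law S.learner env T)
        + 2 * (T * ε) + 2 * √d := by
  let pol : Option S.Net → Policy d := fun i => i.elim π S.netPolicy
  obtain ⟨Y, hY, hYi⟩ := exists_mean_approx_linear (μ := law S.learner env T)
    (V := fun h i => ∑ t : Fin T, policyLoss env (pol i) t (past h t) (h t).state)
    (fun i => integrable_sum_past (fun t => measurable_policyLoss env (pol i) t)
      fun t h s => abs_policyLoss_le env (pol i) t h s)
    (fun i => policyMean env.D (pol i)) T (T * ε) (by
      filter_upwards [hε.ae_sum_le hT] with h hh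
      have hmin := fun t : Fin T => exists_misspec_minimizer (D := env.D)
        (g := env.f t (past h t) (h t).state)
        fun a ha => env.abs_f_le (past h t) (h t).state (by simpa using ha)
      choose y hy hyf using hmin
      refine ⟨∑ t, y t, ?_, fun i => ?_⟩
      · refine (norm_sum_le _ _).trans ((Finset.sum_le_sum fun t _ => hy t).trans ?_)
        simp
      · rw [inner_sum, ← Finset.sum_sub_distrib]
        refine (Finset.abs_sum_le_sum_abs _ _).trans (le_trans ?_ hh)
        exact Finset.sum_le_sum fun t _ => abs_policyLoss_sub_le (pol i) env t _ _ (hyf t))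
  obtain ⟨θ, hθ⟩ := S.exists_gridPoint_near (by omega) (Y := Y) (by rw [hmesh]; exact hY)
  refine ⟨θ, ?_⟩
  have h1 := S.inner_policyMean_netPolicy_le env.D π hθ
  have h2 := (abs_le.1 (hYi (some θ))).2
  have h3 := (abs_le.1 (hYi none)).1
  simp only [pol, Option.elim] at h2 h3
  linarith

/-- The regret bound in terms of the parameters. -/
theorem regret_le (hS : S.Admissible) (env : Environment d S.Expert) {T : ℕ} (hT : 0 < T)
    (hmesh : S.mesh = T) {ε : ℝ} (hε : MisspecBound S.learner env T ε) (π : Policy d)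
    (j : Fin S.levels) :
    regret S.learner env T π ≤ Real.log (Fintype.card S.Expert) / S.rate
      + T * (6 * d * S.explore + 4 * S.rate * d * S.levels + 2 * √(S.reg / (2 * S.rate))
        + (4 * √d) * ε + ε ^ 2 / (4 * S.scale j) + 8 * d * S.scale j)
      + 2 * (T * ε) + 2 * √d := by
  obtain ⟨θ, hθ⟩ := exists_netPolicy_le env hT hmesh hε π
  set μ := law S.learner env T with hμ
  set R : (Fin T → Round d S.Expert env.State) → ℝ := fun h => ∑ t : Fin T,
    roundMean S.learner env t (S.regretFn env π t) (past h t) (h t).state with hR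
  set G : (Fin T → Round d S.Expert env.State) → ℝ := fun h => ∑ t : Fin T,
    roundMean S.learner env t (S.progressFn env (j, θ) t) (past h t) (h t).state with hG
  set Vθ : (Fin T → Round d S.Expert env.State) → ℝ := fun h => ∑ t : Fin T,
    policyLoss env (S.netPolicy θ) t (past h t) (h t).state with hVθ
  set Vπ : (Fin T → Round d S.Expert env.State) → ℝ := fun h => ∑ t : Fin T,
    policyLoss env π t (past h t) (h t).state with hVπ
  have hRi : Integrable R μ := integrable_sum_past
    (fun t => measurable_roundMean (L := S.learner) (S.measurable_regretFn env π t))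
    fun t h s => abs_roundMean_le (L := S.learner) (fun z => S.abs_regretFn_le env π t z) h s
  have hGi : Integrable G μ := integrable_sum_past
    (fun t => measurable_roundMean (L := S.learner) (S.measurable_progressFn env (j, θ) t))
    fun t h s => abs_roundMean_le (L := S.learner)
      (fun z => abs_progress_le hS (j, θ) _ _ _ _) h s
  have hVθi : Integrable Vθ μ := integrable_sum_past
    (fun t => measurable_policyLoss env (S.netPolicy θ) t)
    fun t h s => abs_policyLoss_le env (S.netPolicy θ) t h s
  have hVπi : Integrable Vπ μ := integrable_sum_past
    (fun t => measurable_policyLoss env π t) fun t h s => abs_policyLoss_le env π t h s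
  have hprog : ∫ h, G h ∂μ ≤ Real.log (Fintype.card S.Expert) / S.rate := by
    have htower := integral_law_sum_eq (L := S.learner) (env := env)
      (fun t : Fin T => S.progressFn env (j, θ) t)
      (fun t => S.measurable_progressFn env (j, θ) t)
      (fun t z => abs_progress_le hS (j, θ) _ _ _ _)
    rw [hG, ← htower]
    refine integral_le_of_ae_le_const ?_ (Filter.Eventually.of_forall fun h => ?_)
    · exact integrable_finsetSum _ fun t _ => integrable_of_bound
        ((S.measurable_progressFn env (j, θ) t).comp
          ((measurable_past t).prodMk (measurable_pi_apply t)))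
        fun h => abs_progress_le hS (j, θ) _ _ _ _
    · exact sum_progress_le hS (j, θ) (fun t => (h t).obs)
  -- `R + Vπ` is the learner's own conditional mean loss, so this compares the learner with the grid
  -- policy. The inequality is pathwise, which lets the almost sure bounds on the sums of
  -- misspecifications be applied before integrating.
  have hstep : ∫ h, (R h - G h - Vθ h + Vπ h) ∂μ ≤
      T * (6 * d * S.explore + 4 * S.rate * d * S.levels + 2 * √(S.reg / (2 * S.rate))
        + (4 * √d) * ε + ε ^ 2 / (4 * S.scale j) + 8 * d * S.scale j) := by
    refine integral_le_of_ae_le_const (((hRi.sub hGi).sub hVθi).add hVπi) ?_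
    filter_upwards [hε.ae_sum_le hT, hε.ae_sum_sq_le hT] with h h1 h2
    have hα := hS.scale_pos j
    have hpt : ∀ t : Fin T,
        roundMean S.learner env t (S.regretFn env π t) (past h t) (h t).state
        - roundMean S.learner env t (S.progressFn env (j, θ) t) (past h t) (h t).state
        - policyLoss env (S.netPolicy θ) t (past h t) (h t).state
        + policyLoss env π t (past h t) (h t).state ≤
        (6 * d * S.explore + 4 * S.rate * d * S.levels + 2 * √(S.reg / (2 * S.rate))
          + 8 * d * S.scale j)
          + (4 * √d) * misspec env.D (lossFn S.learner env h t)
          + misspec env.D (lossFn S.learner env h t) ^ 2 / (4 * S.scale j) := by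
      intro t
      have := learnerLoss_sub_le env hS (j, θ) t (past h t) (h t).state
      rw [roundMean_regretFn]
      have e : lossFn S.learner env h t = env.f t (past h t) (h t).state := rfl
      rw [e]
      linarith
    have hsum := Finset.sum_le_sum fun t (_ : t ∈ Finset.univ) => hpt t
    rw [Finset.sum_add_distrib, Finset.sum_sub_distrib, Finset.sum_sub_distrib,
      Finset.sum_add_distrib, Finset.sum_add_distrib, ← Finset.mul_sum, ← Finset.sum_div,
      Finset.sum_const, Finset.card_univ, Fintype.card_fin, nsmul_eq_mul] at hsum
    refine hsum.trans ?_
    have h3 := mul_le_mul_of_nonneg_left h1 (by positivity : 0 ≤ 4 * √(d : ℝ))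
    have h4 := div_le_div_of_nonneg_right h2 (by positivity : 0 ≤ 4 * S.scale j)
    have h5 : (T : ℝ) * ε ^ 2 / (4 * S.scale j) = T * (ε ^ 2 / (4 * S.scale j)) := by ring
    rw [h5] at h4
    linarith
  have hsplit : ∫ h, (R h - G h - Vθ h + Vπ h) ∂μ =
      ∫ h, R h ∂μ - ∫ h, G h ∂μ - ∫ h, Vθ h ∂μ + ∫ h, Vπ h ∂μ := by
    have i1 : Integrable (fun h => R h - G h) μ := hRi.sub hGi
    have i2 : Integrable (fun h => R h - G h - Vθ h) μ := i1.sub hVθi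
    rw [integral_add i2 hVπi, integral_sub i1 hVθi, integral_sub hRi hGi]
  rw [hsplit] at hstep
  rw [regret_eq]
  linarith

/-- The parameters for horizon `T`. -/
def ofHorizon {d T : ℕ} (hd : 1 ≤ d) (hT : 2 ≤ T) : Params d where
  one_le_dim := hd
  mesh := T
  levels := Nat.log 2 T + 2
  levels_pos := by omega
  rate := 1 / √T
  -- The cap makes the parameters legal for every `T`. When it is active, `√T` is so small that the
  -- trivial regret bound is used instead.
  explore := min (1 / 2) (4 * (1 / √T) * d * (Nat.log 2 T + 2 : ℕ))
  explore_nonneg := le_min (by norm_num) (by positivity)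
  explore_le := min_le_left _ _
  -- This is `η / T`, which makes the ridge bias `√(reg / (2η))` of order `1 / √T` per round.
  reg := 1 / √T / T
  reg_pos := by
    have : (0 : ℝ) < T := by exact_mod_cast (by omega : 0 < T)
    positivity
  scale j := (1 / 2) ^ (j : ℕ)

end Params

/-- The smallest of the `Nat.log 2 T + 2` scales is at most `1 / T`. It serves all tiny `a`,
including `a = 0`, at an additive cost of `O(d)` in the regret. -/
theorem exists_dyadic_scale {T : ℕ} (hT : 0 < T) {a : ℝ} (ha1 : a ≤ 1) :
    ∃ j : Fin (Nat.log 2 T + 2), a ≤ (1 / 2 : ℝ) ^ (j : ℕ) ∧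
      (1 / 2 : ℝ) ^ (j : ℕ) ≤ max (2 * a) (1 / T) := by
  have hsmall : (1 / 2 : ℝ) ^ (Nat.log 2 T + 1) ≤ 1 / T := by
    rw [one_div, inv_pow, one_div]
    have : (T : ℝ) ≤ 2 ^ (Nat.log 2 T + 1) := by
      exact_mod_cast (Nat.lt_pow_succ_log_self (by norm_num) T).le
    exact inv_anti₀ (by exact_mod_cast hT) this
  rcases le_or_gt a ((1 / 2 : ℝ) ^ (Nat.log 2 T + 1)) with h | h
  · exact ⟨⟨Nat.log 2 T + 1, by omega⟩, h, hsmall.trans (le_max_right _ _)⟩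
  · have ha : 0 < a := lt_trans (by positivity) h
    obtain ⟨n, hn1, hn2⟩ := exists_nat_pow_near_of_lt_one ha ha1
      (by norm_num : (0 : ℝ) < 1 / 2) (by norm_num)
    have hn : n < Nat.log 2 T + 2 := by
      by_contra! hcon
      have : (1 / 2 : ℝ) ^ n ≤ (1 / 2 : ℝ) ^ (Nat.log 2 T + 1) :=
        pow_le_pow_of_le_one (by norm_num) (by norm_num) (by omega)
      linarith
    refine ⟨⟨n, hn⟩, hn2, le_max_of_le_left ?_⟩
    rw [pow_succ] at hn1
    dsimp only
    linarith

theorem natLog_add_two_le {T : ℕ} (hT : 2 ≤ T) :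
    ((Nat.log 2 T + 2 : ℕ) : ℝ) ≤ 5 * Real.log T := by
  have hl2 := Real.log_two_gt_d9
  have h2T : Real.log 2 ≤ Real.log T :=
    Real.log_le_log (by norm_num) (by exact_mod_cast hT)
  have h1 : (Nat.log 2 T : ℝ) * Real.log 2 ≤ Real.log T := by
    rw [← Real.log_pow]
    refine Real.log_le_log (by positivity) ?_
    exact_mod_cast Nat.pow_log_le_self 2 (by omega)
  push_cast
  nlinarith [(Nat.cast_nonneg (Nat.log 2 T) : (0 : ℝ) ≤ _)]

theorem log_card_expert_le {d T : ℕ} (hd : 1 ≤ d) (hT : 2 ≤ T) :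
    Real.log (Fintype.card (Params.ofHorizon hd hT).Expert) ≤ 5 * d * Real.log T := by
  have hT' : (2 : ℝ) ≤ T := by exact_mod_cast hT
  have hd' : (1 : ℝ) ≤ d := by exact_mod_cast hd
  have hl : 0 ≤ Real.log T := Real.log_nonneg (by linarith)
  have hcard : Fintype.card (Params.ofHorizon hd hT).Expert =
      (Nat.log 2 T + 2) * (2 * T + 1) ^ d := by
    simp [Params.Expert, Params.Net, Params.ofHorizon]
  rw [hcard]
  push_cast
  rw [Real.log_mul (by positivity) (by positivity), Real.log_pow]
  have h1 : Real.log ((Nat.log 2 T : ℝ) + 2) ≤ 2 * Real.log T := by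
    have : (2 : ℝ) * Real.log T = Real.log ((T : ℝ) ^ 2) := by rw [Real.log_pow]; norm_num
    rw [this]
    refine Real.log_le_log (by positivity) ?_
    have h2 : (Nat.log 2 T : ℝ) ≤ T := by
      exact_mod_cast (Nat.log_lt_self 2 (by omega)).le
    nlinarith
  have h3 : Real.log (2 * (T : ℝ) + 1) ≤ 3 * Real.log T := by
    have : (3 : ℝ) * Real.log T = Real.log ((T : ℝ) ^ 3) := by rw [Real.log_pow]; norm_num
    rw [this]
    refine Real.log_le_log (by positivity) ?_
    nlinarith [mul_nonneg (by linarith : (0 : ℝ) ≤ T - 2) (by linarith : (0 : ℝ) ≤ T)]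
  nlinarith [mul_le_mul_of_nonneg_left h3 (by linarith : (0 : ℝ) ≤ d)]

theorem regret_bound_arith {d T ε l M c α r : ℝ} (hd' : 1 ≤ d) (hT' : 2 ≤ T) (hε0 : 0 ≤ ε)
    (hl : 0.69 ≤ l) (hM0 : 0 ≤ M) (hM : M ≤ 5 * l) (hcard : c ≤ 5 * d * l) (hα0 : 0 < α)
    (hj1 : ε / √d ≤ α) (hj2 : α ≤ max (2 * (ε / √d)) (1 / T))
    (hreg : r ≤ c / (1 / √T)
      + T * (6 * d * (4 * (1 / √T) * d * M) + 4 * (1 / √T) * d * M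
        + 2 * √(1 / √T / T / (2 * (1 / √T)))
        + (4 * √d) * ε + ε ^ 2 / (4 * α) + 8 * d * α)
      + 2 * (T * ε) + 2 * √d) :
    r ≤ 1000 * (d ^ 2 * √T * l ^ 2 + √d * ε * T * l) := by
  set q := √T with hq
  have hl0 : 0 < l := by linarith
  have hT0 : 0 < T := by linarith
  have hd0 : 0 < d := by linarith
  have hq1 : 1 ≤ q := Real.one_le_sqrt.2 (by linarith)
  have hq0 : 0 < q := by linarith
  have hqq : q * q = T := Real.mul_self_sqrt (by linarith)
  have hsd : 1 ≤ √d := Real.one_le_sqrt.2 hd'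
  have hsdd : √d * √d = d := Real.mul_self_sqrt (by linarith)
  have hdd : d ≤ d ^ 2 := le_self_pow₀ hd' two_ne_zero
  -- The terms below come out as multiples of `d² √T log T` and `√d ε T`, up to a few multiples of
  -- `d` and `√d`; the remaining logarithms are spent here and in `hBl`.
  have hdql : d ^ 2 * q * l ≤ 1.5 * (d ^ 2 * q * l ^ 2) := by
    have : d ^ 2 * q * l * 0.69 ≤ d ^ 2 * q * l * l := by gcongr
    have h0 : 0 ≤ d ^ 2 * q * l := by positivity
    linarith
  have hBl : √d * ε * T ≤ 1.5 * (√d * ε * T * l) := by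
    have : √d * ε * T * 0.69 ≤ √d * ε * T * l := by gcongr
    have h0 : 0 ≤ √d * ε * T := by positivity
    linarith
  have hX0 : 0 ≤ d ^ 2 * q * l ^ 2 := by positivity
  have hY0 : 0 ≤ √d * ε * T * l := by positivity
  have t1 : c / (1 / q) ≤
      5 * (d ^ 2 * q * l) := by
    rw [div_div_eq_mul_div, div_one]
    calc _ ≤ 5 * d * l * q := by gcongr
      _ = 5 * (d * q * l) := by ring
      _ ≤ _ := by gcongr
  have t2 : T * (6 * d * (4 * (1 / q) * d * M)) ≤ 120 * (d ^ 2 * q * l) := by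
    have e : T * (6 * d * (4 * (1 / q) * d * M)) = 24 * (d ^ 2 * q) * M := by
      rw [← hqq]; field_simp; ring
    rw [e]
    calc _ ≤ 24 * (d ^ 2 * q) * (5 * l) := by gcongr
      _ = _ := by ring
  have t3 : T * (4 * (1 / q) * d * M) ≤ 20 * (d ^ 2 * q * l) := by
    have e : T * (4 * (1 / q) * d * M) = 4 * (d * q) * M := by
      rw [← hqq]; field_simp
    rw [e]
    calc _ ≤ 4 * (d ^ 2 * q) * (5 * l) := by gcongr
      _ = _ := by ring
  have t4 : T * (2 * √(1 / q / T / (2 * (1 / q)))) ≤ 3 * (d ^ 2 * q * l) := by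
    have e : 1 / q / T / (2 * (1 / q)) = 1 / (2 * T) := by
      field_simp
    have h1 : √(1 / q / T / (2 * (1 / q))) ≤ 1 / q := by
      rw [e, Real.sqrt_le_left (by positivity), div_pow, one_pow, sq, hqq]
      gcongr
      linarith
    have h2 : T * (2 * √(1 / q / T / (2 * (1 / q)))) ≤ T * (2 * (1 / q)) := by gcongr
    have h3 : T * (2 * (1 / q)) = 2 * q := by rw [← hqq]; field_simp
    have h4 : q * 0.69 ≤ q * l := by gcongr
    have h5 : 1 * (q * l) ≤ d ^ 2 * (q * l) := by
      have : 0 ≤ q * l := by positivity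
      gcongr
      linarith
    linarith
  have t5 : T * (ε ^ 2 / (4 * α)) ≤ √d * ε * T := by
    have h1 : ε ≤ α * √d := by rwa [div_le_iff₀ (by linarith)] at hj1
    have h2 : ε ^ 2 / (4 * α) ≤ √d * ε := by
      rw [div_le_iff₀ (by positivity)]
      have h3 := mul_le_mul_of_nonneg_left h1 hε0
      have h4 := mul_nonneg (mul_nonneg hα0.le hε0) (Real.sqrt_nonneg d)
      linarith
    calc _ ≤ T * (√d * ε) := by gcongr
      _ = _ := by ring
  have t6 : T * (8 * d * α) ≤ 16 * (√d * ε * T) + 8 * d := by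
    have h1 : α ≤ 2 * (ε / √d) + 1 / T :=
      hj2.trans (max_le (by linarith [show (0 : ℝ) ≤ 1 / T by positivity])
        (by linarith [show (0 : ℝ) ≤ ε / √d by positivity]))
    have h2 : T * (8 * d * α) ≤ T * (8 * d * (2 * (ε / √d) + 1 / T)) := by gcongr
    have h3 : d * (ε / √d) = √d * ε := by
      nth_rewrite 1 [← hsdd]; field_simp
    have h4 : T * (8 * d * (2 * (ε / √d) + 1 / T)) = 16 * (d * (ε / √d) * T) + 8 * d := by
      field_simp
      ring
    rw [h4, h3] at h2
    exact h2
  have t7 : T * ε ≤ √d * ε * T := by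
    calc T * ε = 1 * ε * T := by ring
      _ ≤ √d * ε * T := by gcongr
  have t8 : √d ≤ d := by
    calc √d = √d * 1 := (mul_one _).symm
      _ ≤ √d * √d := by gcongr
      _ = d := hsdd
  have t9 : d ≤ 1.5 * (d ^ 2 * q * l) := by
    have h1 : (1 : ℝ) * 0.69 ≤ q * l := by gcongr
    have h2 : d ^ 2 * 0.69 ≤ d ^ 2 * (q * l) := by
      gcongr; linarith
    linarith
  have t10 : T * ((4 * √d) * ε) = 4 * (√d * ε * T) := by ring
  linarith

/-- The regret bound for the chosen parameters. -/
theorem regret_ofHorizon_le {d T : ℕ} (hd : 1 ≤ d) (hT : 2 ≤ T)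
    (env : Environment d (Params.ofHorizon hd hT).Expert) {ε : ℝ}
    (hε : MisspecBound (Params.ofHorizon hd hT).learner env T ε) (π : Policy d) :
    regret (Params.ofHorizon hd hT).learner env T π ≤
      1000 * ((d : ℝ) ^ 2 * √(T : ℝ) * Real.log T ^ 2 + √(d : ℝ) * ε * T * Real.log T) := by
  have hε0 := hε.nonneg
  have hT' : (2 : ℝ) ≤ T := by exact_mod_cast hT
  have hd' : (1 : ℝ) ≤ d := by exact_mod_cast hd
  have hM := natLog_add_two_le hT
  have hcard := log_card_expert_le hd hT
  have hl : (0.69 : ℝ) ≤ Real.log T := by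
    have := Real.log_two_gt_d9
    have h2T : Real.log 2 ≤ Real.log T := Real.log_le_log (by norm_num) hT'
    linarith
  set l := Real.log T with hldef
  set q := √(T : ℝ) with hq
  set M : ℝ := ((Nat.log 2 T + 2 : ℕ) : ℝ) with hMdef
  have hM2 : 2 ≤ M := by
    rw [hMdef]; push_cast
    linarith [(Nat.cast_nonneg (Nat.log 2 T) : (0 : ℝ) ≤ _)]
  have hq1 : 1 ≤ q := Real.one_le_sqrt.2 (by linarith)
  have hq0 : 0 < q := by linarith
  have hqq : q * q = T := Real.mul_self_sqrt (by linarith)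
  have hsd : 1 ≤ √(d : ℝ) := Real.one_le_sqrt.2 hd'
  have hsdd : √(d : ℝ) * √(d : ℝ) = d := Real.mul_self_sqrt (by linarith)
  have hdd : (d : ℝ) ≤ d ^ 2 := by nlinarith
  have hdql : (d : ℝ) ^ 2 * q * l ≤ 1.5 * (d ^ 2 * q * l ^ 2) := by
    have : 0 ≤ (d : ℝ) ^ 2 * q * l := by positivity
    nlinarith
  have hB0 : 0 ≤ √(d : ℝ) * ε * T := by positivity
  have hBl : √(d : ℝ) * ε * T ≤ 1.5 * (√(d : ℝ) * ε * T * l) := by nlinarith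
  have htriv := Params.regret_le_two_mul (S := Params.ofHorizon hd hT) env T π
  have hX0 : 0 ≤ (d : ℝ) ^ 2 * q * l ^ 2 := by positivity
  -- When `ε > √d` the wanted scale `ε / √d` exceeds the largest available one, but then `2T` is
  -- already below the claimed bound.
  rcases lt_or_ge (√(d : ℝ)) ε with hbig | hεd
  · have h1 : 2 * (T : ℝ) ≤ 2 * (√(d : ℝ) * ε * T) := by
      have : 1 ≤ √(d : ℝ) * ε := by nlinarith
      nlinarith
    linarith
  -- The threshold ensures `32 η d ≤ 1` and an inactive cap on exploration. Below it, `T ≤ 32 M d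
  -- √T`, and the trivial bound suffices.
  rcases lt_or_ge q (32 * M * d) with hsmall | hlarge
  · have h1 : 2 * (T : ℝ) ≤ 320 * (d ^ 2 * q * l) := by
      have h2 : q * q ≤ 32 * M * d * q := by gcongr
      have h3 : M * (d * q) ≤ 5 * l * (d ^ 2 * q) := by gcongr
      nlinarith
    linarith
  have hηM : 4 * (1 / q) * d * M ≤ 1 / 8 := by
    have : 4 * (1 / q) * d * M = 4 * d * M / q := by ring
    rw [this, div_le_iff₀ hq0]
    linarith
  have hexp : (Params.ofHorizon hd hT).explore = 4 * (1 / q) * d * M :=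
    min_eq_right (hηM.trans (by norm_num))
  have hS : (Params.ofHorizon hd hT).Admissible :=
    { rate_pos := by change 0 < 1 / q; positivity
      rate_mul_dim_le := by
        change 32 * (1 / q) * d ≤ 1
        have : 32 * (1 / q) * d = 32 * d / q := by ring
        rw [this, div_le_one hq0]
        nlinarith
      le_explore := by rw [hexp]; exact le_rfl
      scale_pos := fun j => by change (0 : ℝ) < (1 / 2) ^ (j : ℕ); positivity
      scale_le_one := fun j => pow_le_one₀ (by norm_num) (by norm_num) }
  obtain ⟨j, hj1, hj2⟩ := exists_dyadic_scale (T := T) (by omega) (a := ε / √d)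
    ((div_le_one (by linarith)).2 hεd)
  have hreg := Params.regret_le hS env (T := T) (by omega) rfl hε π j
  rw [hexp] at hreg
  change regret (Params.ofHorizon hd hT).learner env T π ≤
      Real.log (Fintype.card (Params.ofHorizon hd hT).Expert) / (1 / q)
      + T * (6 * d * (4 * (1 / q) * d * M) + 4 * (1 / q) * d * M + 2 * √(1 / q / T / (2 * (1 / q)))
        + (4 * √d) * ε + ε ^ 2 / (4 * (1 / 2) ^ (j : ℕ)) + 8 * d * (1 / 2) ^ (j : ℕ))
      + 2 * (T * ε) + 2 * √d at hreg
  exact regret_bound_arith hd' hT' hε0 hl (by positivity) hM hcard (by positivity) hj1 hj2 hreg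

end LinCB

end

theorem mainTheorem4 :
    ∃ C : ℝ, 0 < C ∧ ∀ d T : ℕ, 1 ≤ d → 2 ≤ T →
      ∃ L : LinCB.Learner d,
        ∀ (env : LinCB.Environment d L.Mem) (ε : ℝ), LinCB.MisspecBound L env T ε →
          ∀ π : LinCB.Policy d,
            LinCB.regret L env T π ≤
              C * ((d : ℝ) ^ 2 * √(T : ℝ) * Real.log T ^ 2
                + √(d : ℝ) * ε * T * Real.log T) :=
  ⟨1000, by norm_num, fun _ _ hd hT => ⟨(LinCB.Params.ofHorizon hd hT).learner,
    fun env _ hε π => LinCB.regret_ofHorizon_le hd hT env hε π⟩⟩
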